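/- **Setting.** All Hilbert spaces are complex, with inner products linear in the second argument. Let $\mathfrak h$ and $\mathsf k$ be Hilbert spaces. For $J\subset\mathbb R_+$ let $\mathcal F_J$ be the symmetric Fock space over $L^2(J;\mathsf k)$, and let $\mathcal F=\mathcal F_{\mathbb R_+}$. Write $\varpi(f)=e^{-\|f\|^2/2}\big((n!)^{-1/2}f^{\otimes n}\big)_{n\ge0}$ for the normalised exponential vectors, and identify $\mathcal F=\mathcal F_{[0,t[}\otimes\mathcal F_{[t,\infty[}$ through $\varpi(f)\leftrightarrow\varpi(f|_{[0,t[})\otimes\varpi(f|_{[t,\infty[})$. For a vector $e$ of a Hilbert space, $E_e$ denotes the operator $\xi\mapsto \xi\otimes e$ and $E^e=(E_e)^*$. For a closed subspace $V\subset B(\mathfrak h)$ and a Hilbert space $\mathsf H$ put $$V\otimes_M B(\mathsf H)=\{T\in B(\mathfrak h\otimes \mathsf H): E^dTE_e\in V\ \text{for all } d,e\in \mathsf H\}.$$ If $\mathsf H'$ is another Hilbert space and $\phi:V\to V\otimes_M B(\mathsf H')$ is completely bounded, then $\phi\otimes_M\mathrm{id}_{B(\mathsf H)}$ denotes the unique map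 on $V\otimes_M B(\mathsf H)$, with values in $V\otimes_M B(\mathsf H'\otimes\mathsf H)$, such that $E^d(\phi\otimes_M\mathrm{id})(T)E_e=\phi(E^dTE_e)$ for all $d,e\in\mathsf H$. A *QS cocycle* on $V$ (with noise dimension space $\mathsf k$) is a family $k=(k_t)_{t\ge0}$ of completely bounded linear maps $k_t:V\to V\otimes_M B(\mathcal F)$ such that * $k_t(a)\in V\otimes_M B(\mathcal F_{[0,t[})\otimes I_{[t,\infty[}$ for all $a\in V$ and $t\ge 0$; * $k_0(a)=a\otimes I_{\mathcal F}$ for all $a\in V$; * $k_{r+t}=\widehat k_r\circ\sigma_r\circ k_t$ for all $r,t\ge0$. Here $\sigma_r:V\otimes_M B(\mathcal F)\to V\otimes_M B(\mathcal F_{[r,\infty[})$ is the map $T\mapsto (I\otimes S_r)T(I\otimes S_r)^*$, where $S_r:\mathcal F\to\mathcal F_{[r,\infty[}$ is the unitary with $S_r\varpi(f)=\varpi(f(\cdot-r))$, and $\widehat k_r=k_r\otimes_M\mathrm{id}_{B(\mathcal F_{[r,\infty[})}$, with $k_r$ viewed as a map $V\to V\otimes_M B(\mathcal F_{[0,r[})$.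 For $x,y\in\mathsf k$ and $t\ge0$ let $x_{[0,t[}$ be the function equal to $x$ on $[0,t[$ and to $0$ elsewhere, and define $P^{x,y}_t:V\to V$ by $$P^{x,y}_t(a)=E^{\varpi(x_{[0,t[})}\,k_t(a)\,E_{\varpi(y_{[0,t[})}.$$ For $\mathbf x=(x^1,\dots,x^n)\in\mathsf k^n$ let $P^{\mathbf x}_t:M_n(V)\to M_n(V)$ be the Schur-action map $[a^i_j]\mapsto[P^{x^i,x^j}_t(a^i_j)]$, and let $$\varpi^{\mathbf x}_t=\big[\langle\varpi(x^i_{[0,t[}),\varpi(x^j_{[0,t[})\rangle\big]_{i,j}=\big[e^{-t(\frac12\|x^i\|^2+\frac12\|x^j\|^2-\langle x^i,x^j\rangle)}\big]_{i,j}\in M_n(\mathbb C)_+ .$$ Let $\square_n\in M_n(\mathbb C)$ be the all-ones matrix and let $\circ$ be the Schur (entrywise) product. An *operator system* is a closed self-adjoint subspace of $B(\mathfrak h)$ containing $I$; a *$C^*$-algebra* is a closed $*$-subalgebra of $B(\mathfrak h)$, unital or not. Matrices over $V$ are ordered and normed as operators on $\mathfrak h^n$. The cocycle $k$ is called completely positive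 (respectively contractive, unital) if every $k_t$ is; likewise the semigroups $P^{\mathbf x}$ and $P^{x,x}$. **Proposition.** Let $k$ be a QS cocycle on $V$ and let $\mathsf T$ be a total subset of $\mathsf k$ containing $0$. (a) If $V$ is an operator system or a $C^*$-algebra, the following are equivalent: (i) $k$ is completely positive; (ii) $P^{\mathbf x}$ is completely positive for all $n\ge1$ and $\mathbf x\in\mathsf T^n$; (iii) $P^{\mathbf x}$ is positive for all $n\ge1$ and $\mathbf x\in\mathsf T^n$. (b) If $V$ is an operator system and $k$ is completely positive, the following are equivalent: (i) $k$ is contractive; (ii) $P^{\mathbf x}_t(I\otimes\lambda)\le I\otimes(\varpi^{\mathbf x}_t\circ\lambda)$ for all $n\ge1$, $\mathbf x\in\mathsf T^n$, $\lambda\in M_n(\mathbb C)_+$ and $t\ge0$; (iii) $P^{\mathbf x}_t(I\otimes\square_n)\le I\otimes\varpi^{\mathbf x}_t$ for all $n\ge1$, $\mathbf x\in\mathsf T^n$ and $t\ge0$. Moreover $k$ is unital if and only if equality holds throughout (ii), and if and only if equality holds throughout (iii). (c) If $V$ is an operator system and $k$ is completely positive and contractive, the following are equivalent: (i) $k$ is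 unital; (ii) equality holds throughout (b)(ii); (iii) equality holds throughout (b)(iii); (iv) $P^{x,x}$ is unital for all $x\in\mathsf T$. -/

import Mathlib

open MeasureTheory UniformSpace
open scoped TensorProduct InnerProductSpace NNReal ENNReal Matrix ComplexOrder

set_option linter.unusedSectionVars false

noncomputable section

namespace QSC

universe u v w

section Hilbert

variable {A : Type u} [NormedAddCommGroup A] [InnerProductSpace ℂ A]
variable {B : Type v} [NormedAddCommGroup B] [InnerProductSpace ℂ B]
variable {C : Type w} [NormedAddCommGroup C] [InnerProductSpace ℂ C]

/-- The Hilbert space tensor product: the completion of the algebraic tensor product. -/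
def HTensor (A : Type u) (B : Type v) [NormedAddCommGroup A] [InnerProductSpace ℂ A]
    [NormedAddCommGroup B] [InnerProductSpace ℂ B] : Type (max u v) :=
  Completion (A ⊗[ℂ] B)

instance : NormedAddCommGroup (HTensor A B) :=
  inferInstanceAs (NormedAddCommGroup (Completion (A ⊗[ℂ] B)))

instance : InnerProductSpace ℂ (HTensor A B) :=
  inferInstanceAs (InnerProductSpace ℂ (Completion (A ⊗[ℂ] B)))

instance : CompleteSpace (HTensor A B) :=
  inferInstanceAs (CompleteSpace (Completion (A ⊗[ℂ] B)))

/-- The elementary tensor `a ⊗ b` in the Hilbert space tensor product. -/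
def htmul (a : A) (b : B) : HTensor A B := ((a ⊗ₜ[ℂ] b : A ⊗[ℂ] B) : Completion (A ⊗[ℂ] B))

/-- `u ↦ u ⊗ b`, the operator `E_b = I ⊗ |b⟩ : A → A ⊗ B`. -/
def ketR (A : Type u) [NormedAddCommGroup A] [InnerProductSpace ℂ A] (b : B) :
    A →L[ℂ] HTensor A B :=
  Completion.toComplL ∘L (TensorProduct.mkL ℂ A B).flip b

/-- The ampliation `I_C ⊗ R : C ⊗ A → C ⊗ B` of a bounded operator `R : A → B`. -/
def ampl (C : Type w) [NormedAddCommGroup C] [InnerProductSpace ℂ C] (R : A →L[ℂ] B) :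
    HTensor C A →L[ℂ] HTensor C B :=
  (TensorProduct.mapL (ContinuousLinearMap.id ℂ C) R).completion

/-- The operator `T ⊗ I_C : A ⊗ C → B ⊗ C`. -/
def amplR (C : Type w) [NormedAddCommGroup C] [InnerProductSpace ℂ C] (T : A →L[ℂ] B) :
    HTensor A C →L[ℂ] HTensor B C :=
  (TensorProduct.mapL T (ContinuousLinearMap.id ℂ C)).completion

@[elab_as_elim]
theorem HTensor.induction {p : HTensor A B → Prop} (z : HTensor A B)
    (hc : IsClosed {z | p z}) (h0 : p 0) (ht : ∀ a b, p (htmul a b))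
    (ha : ∀ x y, p x → p y → p (x + y)) : p z := by
  refine Completion.induction_on (p := p) z hc fun t => ?_
  induction t using TensorProduct.induction_on with
  | zero => exact h0
  | tmul x y => exact ht x y
  | add s t hs ht =>
    exact (congrArg p (Completion.coe_add s t)).mpr (ha _ _ hs ht)

theorem HTensor.clm_ext {f g : HTensor A B →L[ℂ] C} (h : ∀ a b, f (htmul a b) = g (htmul a b)) :
    f = g :=
  ContinuousLinearMap.ext fun z => HTensor.induction z (isClosed_eq f.continuous g.continuous)
    (by rw [map_zero, map_zero]) h fun x y hx hy => by rw [map_add, map_add, hx, hy]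

theorem ketR_apply (a : A) (b : B) : ketR A b a = htmul a b := rfl

theorem ampl_htmul (R : A →L[ℂ] B) (c : C) (a : A) :
    ampl C R (htmul c a) = htmul c (R a) :=
  (TensorProduct.mapL (ContinuousLinearMap.id ℂ C) R).completion_apply_coe (c ⊗ₜ[ℂ] a)

theorem amplR_htmul (T : A →L[ℂ] B) (a : A) (c : C) :
    amplR C T (htmul a c) = htmul (T a) c :=
  (TensorProduct.mapL T (ContinuousLinearMap.id ℂ C)).completion_apply_coe (a ⊗ₜ[ℂ] c)

theorem inner_htmul (a a' : A) (b b' : B) :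
    ⟪htmul a b, htmul a' b'⟫_ℂ = ⟪a, a'⟫_ℂ * ⟪b, b'⟫_ℂ :=
  (Completion.inner_coe (𝕜 := ℂ) (a ⊗ₜ[ℂ] b) (a' ⊗ₜ[ℂ] b')).trans (by simp)

theorem smul_htmul_smul (c d : ℂ) (a : A) (b : B) :
    htmul (c • a) (d • b) = (c * d) • htmul a b := by
  rw [htmul, TensorProduct.smul_tmul_smul, Completion.coe_smul]
  rfl

/-- The bounded operator `A → B` with `a i ↦ b i`, extended by linearity and continuity. -/
def gramExt {ι : Type*} (a : ι → A) (b : ι → B) [CompleteSpace B] : A →L[ℂ] B :=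
  (Finsupp.linearCombination ℂ b).extendOfNorm (Finsupp.linearCombination ℂ a)

theorem inner_linearCombination_eq {ι : Type*} (a : ι → A) (b : ι → B)
    (h : ∀ i j, ⟪a i, a j⟫_ℂ = ⟪b i, b j⟫_ℂ) (x y : ι →₀ ℂ) :
    ⟪Finsupp.linearCombination ℂ a x, Finsupp.linearCombination ℂ a y⟫_ℂ =
      ⟪Finsupp.linearCombination ℂ b x, Finsupp.linearCombination ℂ b y⟫_ℂ := by
  simp only [Finsupp.linearCombination_apply, Finsupp.sum, sum_inner, inner_sum,
    inner_smul_left, inner_smul_right, h]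

theorem norm_linearCombination_eq {ι : Type*} (a : ι → A) (b : ι → B)
    (h : ∀ i j, ⟪a i, a j⟫_ℂ = ⟪b i, b j⟫_ℂ) (x : ι →₀ ℂ) :
    ‖Finsupp.linearCombination ℂ a x‖ = ‖Finsupp.linearCombination ℂ b x‖ := by
  rw [@norm_eq_sqrt_re_inner ℂ, @norm_eq_sqrt_re_inner ℂ, inner_linearCombination_eq a b h]

theorem denseRange_linearCombination {ι : Type*} (a : ι → A)
    (ha : Dense (Submodule.span ℂ (Set.range a) : Set A)) :
    DenseRange (Finsupp.linearCombination ℂ a) := by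
  have h := Finsupp.range_linearCombination ℂ (v := a)
  rw [DenseRange, ← LinearMap.coe_range, h]
  exact ha

theorem gramExt_apply [CompleteSpace B] {ι : Type*} (a : ι → A) (b : ι → B)
    (ha : Dense (Submodule.span ℂ (Set.range a) : Set A))
    (h : ∀ i j, ⟪a i, a j⟫_ℂ = ⟪b i, b j⟫_ℂ) (i : ι) : gramExt a b (a i) = b i := by
  have := LinearMap.extendOfNorm_eq (f := Finsupp.linearCombination ℂ b)
    (e := Finsupp.linearCombination ℂ a) (denseRange_linearCombination a ha)
    ⟨1, fun x => by rw [one_mul, norm_linearCombination_eq a b h]⟩ (Finsupp.single i 1)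
  simpa [gramExt] using this

theorem norm_gramExt_apply [CompleteSpace B] {ι : Type*} (a : ι → A) (b : ι → B)
    (ha : Dense (Submodule.span ℂ (Set.range a) : Set A))
    (h : ∀ i j, ⟪a i, a j⟫_ℂ = ⟪b i, b j⟫_ℂ) (x : A) : ‖gramExt a b x‖ = ‖x‖ := by
  have hd := denseRange_linearCombination a ha
  refine hd.induction_on (p := fun x => ‖gramExt a b x‖ = ‖x‖) x
    (isClosed_eq (gramExt a b).continuous.norm continuous_norm) fun y => ?_
  rw [gramExt, LinearMap.extendOfNorm_eq hd
    ⟨1, fun x => by rw [one_mul, norm_linearCombination_eq a b h]⟩,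
    norm_linearCombination_eq a b h]

/-- Elementary tensors of total families are total. -/
theorem dense_span_htmul {ι κ : Type*} (a : ι → A) (b : κ → B)
    (ha : Dense (Submodule.span ℂ (Set.range a) : Set A))
    (hb : Dense (Submodule.span ℂ (Set.range b) : Set B)) :
    Dense (Submodule.span ℂ (Set.range fun p : ι × κ => htmul (a p.1) (b p.2)) :
      Set (HTensor A B)) := by
  set P := Submodule.span ℂ (Set.range fun p : ι × κ => htmul (a p.1) (b p.2)) with hP
  rw [Submodule.dense_iff_topologicalClosure_eq_top] at ha hb ⊢
  have h1 : ∀ (x : A) (j : κ), htmul x (b j) ∈ P.topologicalClosure := by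
    intro x j
    have hx : x ∈ (Submodule.span ℂ (Set.range a)).topologicalClosure := by rw [ha]; trivial
    have hle : (Submodule.span ℂ (Set.range a)).topologicalClosure ≤
        P.topologicalClosure.comap (ketR A (b j)).toLinearMap := by
      refine Submodule.topologicalClosure_minimal _ (Submodule.span_le.2 ?_)
        (P.isClosed_topologicalClosure.preimage (ketR A (b j)).continuous)
      rintro _ ⟨i, rfl⟩
      exact P.le_topologicalClosure (Submodule.subset_span ⟨(i, j), rfl⟩)
    exact hle hx
  have h2 : ∀ (x : A) (y : B), htmul x y ∈ P.topologicalClosure := by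
    intro x y
    have hy : y ∈ (Submodule.span ℂ (Set.range b)).topologicalClosure := by rw [hb]; trivial
    have hle : (Submodule.span ℂ (Set.range b)).topologicalClosure ≤
        P.topologicalClosure.comap
          (Completion.toComplL ∘L TensorProduct.mkL ℂ A B x).toLinearMap := by
      refine Submodule.topologicalClosure_minimal _ (Submodule.span_le.2 ?_)
        (P.isClosed_topologicalClosure.preimage
          (Completion.toComplL ∘L TensorProduct.mkL ℂ A B x).continuous)
      rintro _ ⟨j, rfl⟩
      exact h1 x j
    exact hle hy
  rw [eq_top_iff]
  rintro z -
  exact HTensor.induction z P.isClosed_topologicalClosure P.topologicalClosure.zero_mem h2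
    fun _ _ => P.topologicalClosure.add_mem

end Hilbert

section Fock

/-- A bundled complex Hilbert space, used only to form the tensor powers by recursion. -/
structure HilbertSp : Type (u + 1) where
  carrier : Type u
  [group : NormedAddCommGroup carrier]
  [inner : InnerProductSpace ℂ carrier]
  [complete : CompleteSpace carrier]

attribute [instance] HilbertSp.group HilbertSp.inner HilbertSp.complete

variable (K : Type u) [NormedAddCommGroup K] [InnerProductSpace ℂ K]

/-- The Hilbert space tensor powers `K^{⊗ n}`; the power `0` is (a copy in the universe of `K` of)
the one-dimensional space `ℂ`. -/
def tensorPow : ℕ → HilbertSp.{u}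
  | 0 => ⟨EuclideanSpace ℂ PUnit.{u + 1}⟩
  | n + 1 => ⟨HTensor K (tensorPow n).carrier⟩

variable {K}

/-- The vector `f^{⊗ n}` of `K^{⊗ n}`. -/
def powVec (f : K) : (n : ℕ) → (tensorPow K n).carrier
  | 0 => (EuclideanSpace.single PUnit.unit (1 : ℂ) : EuclideanSpace ℂ PUnit.{u + 1})
  | n + 1 => (htmul f (powVec f n) : HTensor K (tensorPow K n).carrier)

theorem inner_powVec (f g : K) : ∀ n : ℕ, ⟪powVec f n, powVec g n⟫_ℂ = ⟪f, g⟫_ℂ ^ n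
  | 0 => by
    change ⟪(EuclideanSpace.single PUnit.unit (1 : ℂ) : EuclideanSpace ℂ PUnit.{u + 1}),
      EuclideanSpace.single PUnit.unit (1 : ℂ)⟫_ℂ = _
    simp
  | n + 1 => by
    change ⟪htmul f (powVec f n), htmul g (powVec g n)⟫_ℂ = _
    rw [inner_htmul, inner_powVec f g n, pow_succ']

variable (K) in
/-- The symmetric tensor power `K^{∨ n}`: the closed linear span of `{f^{⊗ n} : f ∈ K}`. -/
def symPow (n : ℕ) : Submodule ℂ (tensorPow K n).carrier :=
  (Submodule.span ℂ (Set.range fun f : K => powVec f n)).topologicalClosure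

instance (n : ℕ) : CompleteSpace (symPow K n) :=
  (Submodule.isClosed_topologicalClosure _).completeSpace_coe

variable (K) in
/-- The symmetric Fock space over `K`: the Hilbert space direct sum `⊕ₙ K^{∨ n}`. -/
def Fock : Type u := lp (fun n : ℕ => symPow K n) 2

instance Fock.instNorm : NormedAddCommGroup (Fock K) :=
  inferInstanceAs (NormedAddCommGroup (lp (fun n : ℕ => symPow K n) 2))

instance Fock.instInner : InnerProductSpace ℂ (Fock K) :=
  inferInstanceAs (InnerProductSpace ℂ (lp (fun n : ℕ => symPow K n) 2))

instance Fock.instComplete : CompleteSpace (Fock K) :=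
  inferInstanceAs (CompleteSpace (lp (fun n : ℕ => symPow K n) 2))

/-- The component in `K^{∨ n}` of a vector of the Fock space. -/
def Fock.comp (ξ : Fock K) (n : ℕ) : symPow K n :=
  let η : lp (fun n : ℕ => symPow K n) 2 := ξ
  η n

theorem Fock.hasSum_inner (ξ η : Fock K) :
    HasSum (fun n => ⟪ξ.comp n, η.comp n⟫_ℂ) ⟪ξ, η⟫_ℂ :=
  lp.hasSum_inner (𝕜 := ℂ) (G := fun n : ℕ => symPow K n) ξ η

theorem Fock.ext {ξ η : Fock K} (h : ∀ n, ξ.comp n = η.comp n) : ξ = η :=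
  lp.ext (funext h)

/-- `f^{⊗ n}` as an element of `K^{∨ n}`. -/
def symVec (f : K) (n : ℕ) : symPow K n :=
  ⟨powVec f n, Submodule.le_topologicalClosure _ (Submodule.subset_span ⟨f, rfl⟩)⟩

theorem inner_symVec (f g : K) (n : ℕ) : ⟪symVec f n, symVec g n⟫_ℂ = ⟪f, g⟫_ℂ ^ n :=
  inner_powVec f g n

theorem norm_symVec (f : K) (n : ℕ) : ‖symVec f n‖ = ‖f‖ ^ n := by
  have h := inner_symVec f f n
  rw [inner_self_eq_norm_sq_to_K, inner_self_eq_norm_sq_to_K] at h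
  have h' : ‖symVec f n‖ ^ 2 = (‖f‖ ^ n) ^ 2 := by
    rw [← pow_mul, mul_comm n 2, pow_mul]; exact_mod_cast h
  exact (pow_left_inj₀ (norm_nonneg _) (by positivity) two_ne_zero).1 h'

/-- The coefficient sequence of the normalised exponential vector of `f`. -/
def expSeq (f : K) (n : ℕ) : symPow K n :=
  (((Real.exp (-(‖f‖ ^ 2) / 2) / Real.sqrt n.factorial : ℝ)) : ℂ) • symVec f n

theorem inner_expSeq (f g : K) (n : ℕ) :
    ⟪expSeq f n, expSeq g n⟫_ℂ =
      ((Real.exp (-(‖f‖ ^ 2) / 2) * Real.exp (-(‖g‖ ^ 2) / 2) : ℝ) : ℂ) *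
        (⟪f, g⟫_ℂ ^ n / (n.factorial : ℂ)) := by
  have h : ((Real.sqrt n.factorial : ℝ) : ℂ) * ((Real.sqrt n.factorial : ℝ) : ℂ) =
      (n.factorial : ℂ) := by
    rw [← Complex.ofReal_mul, Real.mul_self_sqrt (by positivity)]; simp
  rw [expSeq, expSeq, inner_smul_left, inner_smul_right, inner_symVec, Complex.conj_ofReal, ← h]
  push_cast
  ring

theorem memℓp_expSeq (f : K) : Memℓp (expSeq f) 2 := by
  refine memℓp_gen ?_
  have h : ∀ n, ‖expSeq f n‖ ^ (2 : ℝ≥0∞).toReal =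
      (Real.exp (-(‖f‖ ^ 2) / 2) * Real.exp (-(‖f‖ ^ 2) / 2)) *
        ((‖f‖ ^ 2) ^ n / (n.factorial : ℝ)) := by
    intro n
    have h1 := inner_expSeq f f n
    rw [inner_self_eq_norm_sq_to_K, inner_self_eq_norm_sq_to_K] at h1
    have h2 : ((‖expSeq f n‖ ^ 2 : ℝ) : ℂ) = (((Real.exp (-(‖f‖ ^ 2) / 2) *
        Real.exp (-(‖f‖ ^ 2) / 2)) * ((‖f‖ ^ 2) ^ n / (n.factorial : ℝ)) : ℝ) : ℂ) := by
      push_cast at h1 ⊢; exact h1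
    rw [← Complex.ofReal_injective h2]
    simp
  simp_rw [h]
  exact (Real.summable_pow_div_factorial _).mul_left _

/-- The normalised exponential (coherent) vector
`ϖ(f) = exp (-‖f‖² / 2) ((n!)^{-1/2} f^{⊗ n})_{n ≥ 0}`. -/
def expVec (f : K) : Fock K := ⟨expSeq f, memℓp_expSeq f⟩

theorem inner_expVec (f g : K) :
    ⟪expVec f, expVec g⟫_ℂ =
      Complex.exp (-((‖f‖ ^ 2 + ‖g‖ ^ 2) / 2 - ⟪f, g⟫_ℂ)) := by
  refine (Fock.hasSum_inner (expVec f) (expVec g)).tsum_eq.symm.trans ?_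
  change ∑' n, ⟪expSeq f n, expSeq g n⟫_ℂ = _
  simp_rw [inner_expSeq]
  rw [tsum_mul_left, ← congrFun (NormedSpace.exp_eq_tsum_div (𝔸 := ℂ)) ⟪f, g⟫_ℂ,
    ← Complex.exp_eq_exp_ℂ, ← Real.exp_add, Complex.ofReal_exp, ← Complex.exp_add]
  congr 1
  push_cast
  ring

theorem powVec_smul (c : ℂ) (f : K) : ∀ n : ℕ, powVec (c • f) n = c ^ n • powVec f n
  | 0 => by
    change powVec f 0 = _
    simp
  | n + 1 => by
    change (htmul (c • f) (powVec (c • f) n) : HTensor K (tensorPow K n).carrier) =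
      c ^ (n + 1) • (htmul f (powVec f n) : HTensor K (tensorPow K n).carrier)
    rw [powVec_smul c f n, pow_succ', smul_htmul_smul]

theorem symVec_smul (c : ℂ) (f : K) (n : ℕ) : symVec (c • f) n = c ^ n • symVec f n :=
  Subtype.ext (powVec_smul c f n)

/-- Exponential vectors are total. -/
theorem dense_span_expVec :
    Dense (Submodule.span ℂ (Set.range (expVec : K → Fock K)) : Set (Fock K)) := by
  rw [Submodule.dense_iff_topologicalClosure_eq_top, Submodule.topologicalClosure_eq_top_iff,
    Submodule.eq_bot_iff]
  intro ξ hξ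
  have h0 : ∀ f : K, ⟪expVec f, ξ⟫_ℂ = 0 := fun f =>
    (Submodule.mem_orthogonal _ _).1 hξ _ (Submodule.subset_span ⟨f, rfl⟩)
  have h1 : ∀ (f : K) (n : ℕ), ⟪symVec f n, ξ.comp n⟫_ℂ = 0 := by
    intro f n
    set c : ℕ → ℂ := fun m => ((1 / Real.sqrt m.factorial : ℝ) : ℂ) * ⟪symVec f m, ξ.comp m⟫_ℂ
      with hc
    have hs : HasFPowerSeriesAt (fun _ : ℂ => (0 : ℂ))
        (FormalMultilinearSeries.ofScalars ℂ c) 0 := by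
      rw [hasFPowerSeriesAt_iff]
      refine Filter.Eventually.of_forall fun z => ?_
      have hz := Fock.hasSum_inner (expVec ((starRingEnd ℂ z) • f)) ξ
      rw [h0] at hz
      have hz2 := hz.mul_left ((Real.exp (‖(starRingEnd ℂ z) • f‖ ^ 2 / 2) : ℝ) : ℂ)
      rw [mul_zero] at hz2
      refine hz2.congr_fun ?_
      intro m
      change z ^ m • (FormalMultilinearSeries.ofScalars ℂ c).coeff m = _ *
        ⟪expSeq ((starRingEnd ℂ z) • f) m, ξ.comp m⟫_ℂ
      rw [FormalMultilinearSeries.coeff_ofScalars, expSeq, symVec_smul, inner_smul_left,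
        inner_smul_left, Complex.conj_ofReal, map_pow, Complex.conj_conj, hc]
      set q := ‖(starRingEnd ℂ z) • f‖
      have he : ((Real.exp (q ^ 2 / 2) : ℝ) : ℂ) * ((Real.exp (-(q ^ 2) / 2) : ℝ) : ℂ) = 1 := by
        rw [← Complex.ofReal_mul, ← Real.exp_add]
        norm_num [neg_div]
      have he' : ((Real.exp (-(q ^ 2) / 2) / Real.sqrt m.factorial : ℝ) : ℂ) =
          ((Real.exp (-(q ^ 2) / 2) : ℝ) : ℂ) * ((1 / Real.sqrt m.factorial : ℝ) : ℂ) := by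
        push_cast; ring
      rw [he', smul_eq_mul]
      linear_combination (-(z ^ m * ((1 / Real.sqrt m.factorial : ℝ) : ℂ) *
        ⟪symVec f m, ξ.comp m⟫_ℂ)) * he
    have h2 := hs.eq_zero
    have h3 : c n = 0 := by
      have := congrArg (fun p => FormalMultilinearSeries.coeff p n) h2
      rw [FormalMultilinearSeries.coeff_ofScalars] at this
      rw [this]
      simp [FormalMultilinearSeries.coeff]
    have h4 : ((1 / Real.sqrt n.factorial : ℝ) : ℂ) ≠ 0 := by
      have : (0 : ℝ) < 1 / Real.sqrt n.factorial := by positivity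
      exact_mod_cast this.ne'
    exact (mul_eq_zero.1 h3).resolve_left h4
  refine Fock.ext fun n => ?_
  have h5 : ((ξ.comp n : symPow K n) : (tensorPow K n).carrier) ∈ (symPow K n)ᗮ := by
    change _ ∈ (Submodule.topologicalClosure _)ᗮ
    rw [Submodule.orthogonal_closure, Submodule.mem_orthogonal]
    intro u hu
    induction hu using Submodule.span_induction with
    | mem x hx => obtain ⟨f, rfl⟩ := hx; exact h1 f n
    | zero => simp
    | add x y _ _ hx hy => rw [inner_add_left, hx, hy, add_zero]
    | smul a x _ hx => rw [inner_smul_left, hx, mul_zero]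
  have h6 := (Submodule.mem_orthogonal _ _).1 h5 _ (ξ.comp n).2
  exact Subtype.ext (inner_self_eq_zero.1 h6)

variable {K₁ : Type u} [NormedAddCommGroup K₁] [InnerProductSpace ℂ K₁]
variable {K₂ : Type u} [NormedAddCommGroup K₂] [InnerProductSpace ℂ K₂]

/-- Second quantisation of an isometry `R`: the isometry with `ϖ(f) ↦ ϖ(R f)`. -/
def secondQuant (R : K₁ →ₗᵢ[ℂ] K₂) : Fock K₁ →L[ℂ] Fock K₂ :=
  gramExt (fun f : K₁ => expVec f) (fun f => expVec (R f))

theorem secondQuant_expVec (R : K₁ →ₗᵢ[ℂ] K₂) (f : K₁) :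
    secondQuant R (expVec f) = expVec (R f) :=
  gramExt_apply _ _ dense_span_expVec
    (fun f g => by simp only [inner_expVec, R.norm_map, R.inner_map_map]) f

theorem norm_secondQuant (R : K₁ →ₗᵢ[ℂ] K₂) (ξ : Fock K₁) : ‖secondQuant R ξ‖ = ‖ξ‖ :=
  norm_gramExt_apply _ _ dense_span_expVec
    (fun f g => by simp only [inner_expVec, R.norm_map, R.inner_map_map]) ξ

/-- For isometries `i`, `j` into `K` with orthogonal ranges, the isometry
`Γ(K₁) ⊗ Γ(K₂) → Γ(K)` with `ϖ(f) ⊗ ϖ(g) ↦ ϖ(i f + j g)`. -/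
def fockMul (i : K₁ →ₗᵢ[ℂ] K) (j : K₂ →ₗᵢ[ℂ] K) :
    HTensor (Fock K₁) (Fock K₂) →L[ℂ] Fock K :=
  gramExt (fun p : K₁ × K₂ => htmul (expVec p.1) (expVec p.2))
    (fun p => expVec (i p.1 + j p.2))

theorem fockMul_gram (i : K₁ →ₗᵢ[ℂ] K) (j : K₂ →ₗᵢ[ℂ] K) (h : ∀ f g, ⟪i f, j g⟫_ℂ = 0)
    (p q : K₁ × K₂) :
    ⟪htmul (expVec p.1) (expVec p.2), htmul (expVec q.1) (expVec q.2)⟫_ℂ =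
      ⟪expVec (i p.1 + j p.2), expVec (i q.1 + j q.2)⟫_ℂ := by
  have hn : ∀ r : K₁ × K₂, ‖i r.1 + j r.2‖ ^ 2 = ‖r.1‖ ^ 2 + ‖r.2‖ ^ 2 := by
    intro r
    have := norm_add_sq_eq_norm_sq_add_norm_sq_of_inner_eq_zero (i r.1) (j r.2) (h r.1 r.2)
    simpa [pow_two] using this
  have hc : ⟪j p.2, i q.1⟫_ℂ = 0 := by rw [← inner_conj_symm, h, map_zero]
  rw [inner_htmul, inner_expVec, inner_expVec, inner_expVec, ← Complex.exp_add]
  congr 1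
  have e1 := congrArg (fun x : ℝ => (x : ℂ)) (hn p)
  have e2 := congrArg (fun x : ℝ => (x : ℂ)) (hn q)
  push_cast at e1 e2
  rw [e1, e2, inner_add_left, inner_add_right, inner_add_right, i.inner_map_map,
    j.inner_map_map, h, hc]
  ring

theorem fockMul_htmul (i : K₁ →ₗᵢ[ℂ] K) (j : K₂ →ₗᵢ[ℂ] K) (h : ∀ f g, ⟪i f, j g⟫_ℂ = 0)
    (f : K₁) (g : K₂) : fockMul i j (htmul (expVec f) (expVec g)) = expVec (i f + j g) :=
  gramExt_apply _ _ (dense_span_htmul _ _ dense_span_expVec dense_span_expVec)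
    (fockMul_gram i j h) (f, g)

theorem norm_fockMul (i : K₁ →ₗᵢ[ℂ] K) (j : K₂ →ₗᵢ[ℂ] K) (h : ∀ f g, ⟪i f, j g⟫_ℂ = 0)
    (z : HTensor (Fock K₁) (Fock K₂)) : ‖fockMul i j z‖ = ‖z‖ :=
  norm_gramExt_apply _ _ (dense_span_htmul _ _ dense_span_expVec dense_span_expVec)
    (fockMul_gram i j h) z

end Fock

section NoiseSpace

variable (N : Type u) [NormedAddCommGroup N] [InnerProductSpace ℂ N]

/-- `L²(J; N)` for `J ⊆ ℝ`, realised as the space of those elements of `L²(ℝ; N)` that vanish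
almost everywhere off `J`. -/
def L2On (J : Set ℝ) : Submodule ℂ (Lp N 2 (volume : Measure ℝ)) where
  carrier := {f | ∀ᵐ s, s ∉ J → f s = 0}
  zero_mem' := by
    filter_upwards [Lp.coeFn_zero N 2 (volume : Measure ℝ)] with s hs _
    rw [hs]; rfl
  add_mem' := by
    intro f g hf hg
    filter_upwards [hf, hg, Lp.coeFn_add f g] with s h1 h2 h3 hs
    rw [h3, Pi.add_apply, h1 hs, h2 hs, add_zero]
  smul_mem' := by
    intro c f hf
    filter_upwards [hf, Lp.coeFn_smul c f] with s h1 h2 hs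
    rw [h2, Pi.smul_apply, h1 hs, smul_zero]

/-- The symmetric Fock space `F_J` over `L²(J; N)`. -/
def FockOn (J : Set ℝ) : Type u := Fock (L2On N J)

instance (J : Set ℝ) : NormedAddCommGroup (FockOn N J) :=
  Fock.instNorm (K := L2On N J)

instance (J : Set ℝ) : InnerProductSpace ℂ (FockOn N J) :=
  Fock.instInner (K := L2On N J)

instance (J : Set ℝ) : CompleteSpace (FockOn N J) :=
  Fock.instComplete (K := L2On N J)

variable {N} in
/-- The normalised exponential vector `ϖ(f)` in `F_J`, for `f ∈ L²(J; N)`. -/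
def expOn {J : Set ℝ} (f : L2On N J) : FockOn N J := (expVec f : Fock (L2On N J))

/-- The symmetric Fock space `F` over `L²(ℝ₊; N)`. -/
abbrev NoiseFock : Type u := FockOn N (Set.Ici 0)

variable {N}

theorem inner_expOn {J : Set ℝ} (f g : L2On N J) :
    ⟪expOn f, expOn g⟫_ℂ = Complex.exp (-((‖f‖ ^ 2 + ‖g‖ ^ 2) / 2 - ⟪f, g⟫_ℂ)) :=
  inner_expVec f g

theorem dense_span_expOn {J : Set ℝ} :
    Dense (Submodule.span ℂ (Set.range (expOn : L2On N J → FockOn N J)) : Set (FockOn N J)) :=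
  dense_span_expVec

theorem L2On_mono {J J' : Set ℝ} (h : J ⊆ J') : L2On N J ≤ L2On N J' := by
  intro f hf
  have hf' : ∀ᵐ s, s ∉ J → f s = 0 := hf
  change ∀ᵐ s, s ∉ J' → f s = 0
  filter_upwards [hf'] with s hs hs'
  exact hs fun hJ => hs' (h hJ)

theorem inner_L2On_of_disjoint {J J' : Set ℝ} (h : Disjoint J J') (f : L2On N J)
    (g : L2On N J') : ⟪(f : Lp N 2 (volume : Measure ℝ)), (g : Lp N 2 (volume : Measure ℝ))⟫_ℂ
      = 0 := by
  rw [L2.inner_def]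
  refine integral_eq_zero_of_ae ?_
  filter_upwards [f.2, g.2] with s hf hg
  by_cases hs : s ∈ J
  · rw [hg (Set.disjoint_left.1 h hs), inner_zero_right]; rfl
  · rw [hf hs, inner_zero_left]; rfl

/-- Extension by zero, `L²(J; N) → L²(J'; N)` for `J ⊆ J'`. -/
def extendL2 {J J' : Set ℝ} (h : J ⊆ J') : L2On N J →ₗᵢ[ℂ] L2On N J' where
  toLinearMap := Submodule.inclusion (L2On_mono h)
  norm_map' _ := rfl

variable (N) in
/-- Extension by zero, `L²([0,t[; N) → L²(ℝ₊; N)`. -/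
def embPast (t : ℝ≥0) : L2On N (Set.Ico 0 (t : ℝ)) →ₗᵢ[ℂ] L2On N (Set.Ici 0) :=
  extendL2 Set.Ico_subset_Ici_self

variable (N) in
/-- Extension by zero, `L²([t,∞[; N) → L²(ℝ₊; N)`. -/
def embFuture (t : ℝ≥0) : L2On N (Set.Ici (t : ℝ)) →ₗᵢ[ℂ] L2On N (Set.Ici 0) :=
  extendL2 (Set.Ici_subset_Ici.2 t.2)

theorem inner_embPast_embFuture (t : ℝ≥0) (f : L2On N (Set.Ico 0 (t : ℝ)))
    (g : L2On N (Set.Ici (t : ℝ))) : ⟪embPast N t f, embFuture N t g⟫_ℂ = 0 :=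
  inner_L2On_of_disjoint (J := Set.Ico 0 (t : ℝ)) (J' := Set.Ici (t : ℝ))
    (Set.disjoint_left.2 fun _ h1 h2 => not_lt.2 h2 h1.2) f g

variable (N) in
/-- The identification `F_[0,t[ ⊗ F_[t,∞[ = F`, `ϖ(f) ⊗ ϖ(g) ↦ ϖ(f + g)`. -/
def fockJoin (t : ℝ≥0) :
    HTensor (FockOn N (Set.Ico 0 (t : ℝ))) (FockOn N (Set.Ici (t : ℝ))) →L[ℂ] NoiseFock N :=
  fockMul (embPast N t) (embFuture N t)

theorem fockJoin_htmul (t : ℝ≥0) (f : L2On N (Set.Ico 0 (t : ℝ)))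
    (g : L2On N (Set.Ici (t : ℝ))) :
    fockJoin N t (htmul (expOn f) (expOn g)) = expOn (embPast N t f + embFuture N t g) :=
  fockMul_htmul (embPast N t) (embFuture N t) (inner_embPast_embFuture t) f g

theorem norm_fockJoin (t : ℝ≥0)
    (z : HTensor (FockOn N (Set.Ico 0 (t : ℝ))) (FockOn N (Set.Ici (t : ℝ)))) :
    ‖fockJoin N t z‖ = ‖z‖ :=
  norm_fockMul (embPast N t) (embFuture N t) (inner_embPast_embFuture t) z

variable (N) in
/-- The right shift `(s_r f)(s) = f(s - r)`, as an isometry from `L²(ℝ₊; N)` onto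
`L²([r,∞[; N)`. -/
def shiftL2 (r : ℝ≥0) : L2On N (Set.Ici 0) →ₗᵢ[ℂ] L2On N (Set.Ici (r : ℝ)) where
  toFun f := ⟨Lp.compMeasurePreservingₗᵢ ℂ (fun s : ℝ => s - r)
    (measurePreserving_sub_right volume (r : ℝ)) f, by
      have hp := measurePreserving_sub_right (volume : Measure ℝ) (r : ℝ)
      filter_upwards [Lp.coeFn_compMeasurePreserving (f : Lp N 2 (volume : Measure ℝ)) hp,
        hp.quasiMeasurePreserving.ae f.2] with s h1 h2 hs
      refine h1.trans (h2 fun h0 => hs ?_)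
      simpa using h0⟩
  map_add' f g := Subtype.ext (map_add _ _ _)
  map_smul' c f := Subtype.ext (map_smul _ _ _)
  norm_map' f := (Lp.compMeasurePreservingₗᵢ ℂ (fun s : ℝ => s - r)
    (measurePreserving_sub_right volume (r : ℝ))).norm_map (f : Lp N 2 (volume : Measure ℝ))

variable (N) in
/-- The second quantised shift `F → F_[r,∞[`, `ϖ(f) ↦ ϖ(s_r f)`. -/
def fockShift (r : ℝ≥0) : NoiseFock N →L[ℂ] FockOn N (Set.Ici (r : ℝ)) :=
  secondQuant (shiftL2 N r)

theorem fockShift_expOn (r : ℝ≥0) (f : L2On N (Set.Ici 0)) :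
    fockShift N r (expOn f) = expOn (shiftL2 N r f) :=
  secondQuant_expVec (shiftL2 N r) f

theorem norm_fockShift (r : ℝ≥0) (ξ : NoiseFock N) : ‖fockShift N r ξ‖ = ‖ξ‖ :=
  norm_secondQuant (shiftL2 N r) ξ

/-- The function `x_[0,t[`, equal to `x` on `[0,t[` and to `0` elsewhere, in `L²(ℝ₊; N)`. -/
def constOn (x : N) (t : ℝ≥0) : L2On N (Set.Ici 0) :=
  ⟨indicatorConstLp 2 (measurableSet_Ico (a := (0 : ℝ)) (b := (t : ℝ))) (by simp) x, by
    filter_upwards [indicatorConstLp_coeFn (p := 2) (μ := (volume : Measure ℝ))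
      (hs := measurableSet_Ico (a := (0 : ℝ)) (b := (t : ℝ))) (hμs := by simp) (c := x)]
      with s h1 hs
    rw [h1, Set.indicator_of_notMem fun h => hs h.1]⟩

/-- The coherent vector `ϖ(x_[0,t[)` in `F`. -/
def coh (x : N) (t : ℝ≥0) : NoiseFock N := expOn (constOn x t)

end NoiseSpace

section OperatorSpaces

variable {H : Type u} [NormedAddCommGroup H] [InnerProductSpace ℂ H] [CompleteSpace H]
variable {H' : Type v} [NormedAddCommGroup H'] [InnerProductSpace ℂ H'] [CompleteSpace H']

/-- A concrete operator system: a closed self-adjoint subspace of `B(H)` containing `I`. -/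
def IsOperatorSystem (V : Submodule ℂ (H →L[ℂ] H)) : Prop :=
  IsClosed (V : Set (H →L[ℂ] H)) ∧ (∀ a ∈ V, star a ∈ V) ∧ 1 ∈ V

theorem IsOperatorSystem.one_mem {V : Submodule ℂ (H →L[ℂ] H)} (hV : IsOperatorSystem V) :
    1 ∈ V := hV.2.2

/-- A concrete (not necessarily unital) C*-algebra: a closed self-adjoint subalgebra of `B(H)`. -/
def IsConcreteCStarAlgebra (V : Submodule ℂ (H →L[ℂ] H)) : Prop :=
  IsClosed (V : Set (H →L[ℂ] H)) ∧ (∀ a ∈ V, star a ∈ V) ∧ ∀ a ∈ V, ∀ b ∈ V, a * b ∈ V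

/-- The injection `H → Hⁿ` of the `j`-th summand. -/
def inj (n : ℕ) (j : Fin n) : H →L[ℂ] PiLp 2 (fun _ : Fin n => H) :=
  (PiLp.continuousLinearEquiv 2 ℂ (fun _ : Fin n => H)).symm.toContinuousLinearMap ∘L
    ContinuousLinearMap.single ℂ (fun _ : Fin n => H) j

/-- The `(i,j)` entry of an operator on `Hⁿ`. -/
def entry {n : ℕ} (T : PiLp 2 (fun _ : Fin n => H) →L[ℂ] PiLp 2 (fun _ : Fin n => H))
    (i j : Fin n) : H →L[ℂ] H :=
  PiLp.proj 2 (fun _ : Fin n => H) i ∘L T ∘L inj n j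

/-- The operator on `Hⁿ` with matrix `[a i j]`. -/
def ofEntries {n : ℕ} (a : Fin n → Fin n → (H →L[ℂ] H)) :
    PiLp 2 (fun _ : Fin n => H) →L[ℂ] PiLp 2 (fun _ : Fin n => H) :=
  ∑ i, ∑ j, inj n i ∘L a i j ∘L PiLp.proj 2 (fun _ : Fin n => H) j

theorem proj_inj {n : ℕ} (i j : Fin n) (u : H) :
    (inj n j u : PiLp 2 (fun _ : Fin n => H)) i = if i = j then u else 0 := by
  simp [inj]

theorem ofEntries_apply {n : ℕ} (a : Fin n → Fin n → (H →L[ℂ] H))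
    (v : PiLp 2 (fun _ : Fin n => H)) (i : Fin n) : ofEntries a v i = ∑ j, a i j (v j) := by
  simp [ofEntries, proj_inj]

theorem entry_ofEntries {n : ℕ} (a : Fin n → Fin n → (H →L[ℂ] H)) (i j : Fin n) :
    entry (ofEntries a) i j = a i j := by
  ext u
  simp only [entry, ContinuousLinearMap.comp_apply, PiLp.proj_apply, ofEntries_apply, proj_inj]
  rw [Finset.sum_eq_single j] <;> simp +contextual

theorem ofEntries_add {n : ℕ} (a b : Fin n → Fin n → (H →L[ℂ] H)) :
    ofEntries (fun i j => a i j + b i j) = ofEntries a + ofEntries b := by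
  ext v i
  simp [ofEntries_apply, Finset.sum_add_distrib]

theorem ofEntries_smul {n : ℕ} (c : ℂ) (a : Fin n → Fin n → (H →L[ℂ] H)) :
    ofEntries (fun i j => c • a i j) = c • ofEntries a := by
  ext v i
  simp [ofEntries_apply, Finset.smul_sum]

theorem entry_add {n : ℕ} (S T : PiLp 2 (fun _ : Fin n => H) →L[ℂ] PiLp 2 (fun _ : Fin n => H))
    (i j : Fin n) : entry (S + T) i j = entry S i j + entry T i j := by
  ext u; simp [entry]

theorem entry_smul {n : ℕ} (c : ℂ)
    (T : PiLp 2 (fun _ : Fin n => H) →L[ℂ] PiLp 2 (fun _ : Fin n => H))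
    (i j : Fin n) : entry (c • T) i j = c • entry T i j := by
  ext u; simp [entry]

/-- The operator space `M_n(V)` in `B(Hⁿ)`: the operators all of whose entries lie in `V`. -/
def matSpace (n : ℕ) (V : Submodule ℂ (H →L[ℂ] H)) :
    Submodule ℂ (PiLp 2 (fun _ : Fin n => H) →L[ℂ] PiLp 2 (fun _ : Fin n => H)) where
  carrier := {T | ∀ i j, entry T i j ∈ V}
  zero_mem' i j := by simp [entry]
  add_mem' hS hT i j := by
    rw [entry_add]; exact V.add_mem (hS i j) (hT i j)
  smul_mem' c T hT i j := by
    rw [entry_smul]; exact V.smul_mem c (hT i j)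

theorem ofEntries_mem {V : Submodule ℂ (H →L[ℂ] H)} {n : ℕ} {a : Fin n → Fin n → (H →L[ℂ] H)}
    (ha : ∀ i j, a i j ∈ V) : ofEntries a ∈ matSpace n V := fun i j => by
  rw [entry_ofEntries]; exact ha i j

variable {V : Submodule ℂ (H →L[ℂ] H)} {W : Submodule ℂ (H' →L[ℂ] H')}

/-- The Schur-action map `[a i j] ↦ [φ i j (a i j)]` from `M_n(V)` to `M_n(W)`. -/
def schurMap {n : ℕ} (φ : Fin n → Fin n → (V →ₗ[ℂ] W)) : matSpace n V →ₗ[ℂ] matSpace n W where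
  toFun T := ⟨ofEntries fun i j => (φ i j ⟨entry T.1 i j, T.2 i j⟩ : H' →L[ℂ] H'),
    ofEntries_mem fun i j => (φ i j _).2⟩
  map_add' S T := by
    refine Subtype.ext ?_
    change ofEntries _ = ofEntries _ + ofEntries _
    rw [← ofEntries_add]
    congr 1
    funext i j
    have h : (⟨entry (S + T).1 i j, (S + T).2 i j⟩ : V) =
        ⟨entry S.1 i j, S.2 i j⟩ + ⟨entry T.1 i j, T.2 i j⟩ :=
      Subtype.ext (entry_add S.1 T.1 i j)
    rw [h, map_add]
    rfl
  map_smul' c T := by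
    refine Subtype.ext ?_
    change ofEntries _ = c • ofEntries _
    rw [← ofEntries_smul]
    congr 1
    funext i j
    have h : (⟨entry (c • T).1 i j, (c • T).2 i j⟩ : V) = c • ⟨entry T.1 i j, T.2 i j⟩ :=
      Subtype.ext (entry_smul c T.1 i j)
    rw [h, map_smul]
    rfl

/-- The matrix lifting `φ^(n) : M_n(V) → M_n(W)`, `[a i j] ↦ [φ (a i j)]`. -/
def matLift (n : ℕ) (φ : V →ₗ[ℂ] W) : matSpace n V →ₗ[ℂ] matSpace n W :=
  schurMap fun _ _ => φ

/-- Positivity of a linear map between subspaces of `B(H)` and `B(H')`. -/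
def IsPositiveMap (φ : V →ₗ[ℂ] W) : Prop :=
  ∀ a : V, 0 ≤ (a : H →L[ℂ] H) → 0 ≤ (φ a : H' →L[ℂ] H')

/-- Complete positivity: every matrix lifting is positive. -/
def IsCompletelyPositive (φ : V →ₗ[ℂ] W) : Prop :=
  ∀ n : ℕ, IsPositiveMap (matLift n φ)

/-- Complete boundedness: the matrix liftings are uniformly bounded. -/
def IsCompletelyBounded (φ : V →ₗ[ℂ] W) : Prop :=
  ∃ C : ℝ, ∀ (n : ℕ) (T : matSpace n V), ‖matLift n φ T‖ ≤ C * ‖T‖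

/-- Contractivity. -/
def IsContractiveMap (φ : V →ₗ[ℂ] W) : Prop := ∀ a : V, ‖φ a‖ ≤ ‖a‖

end OperatorSpaces

section MatrixSpaces

variable {H : Type u} [NormedAddCommGroup H] [InnerProductSpace ℂ H] [CompleteSpace H]
variable {F : Type v} [NormedAddCommGroup F] [InnerProductSpace ℂ F] [CompleteSpace F]
variable {F' : Type w} [NormedAddCommGroup F'] [InnerProductSpace ℂ F'] [CompleteSpace F']

/-- The slice `E^d T E_e ∈ B(H)` of an operator `T` on `H ⊗ F`, where `E_e = I_H ⊗ |e⟩` and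
`E^d = (E_d)^*`. -/
def slice (d e : F) : (HTensor H F →L[ℂ] HTensor H F) →ₗ[ℂ] (H →L[ℂ] H) where
  toFun T := (ketR H d).adjoint ∘L T ∘L ketR H e
  map_add' S T := by ext; simp
  map_smul' c T := by ext; simp

/-- The right `F`-matrix space `V ⊗_M B(F)` over `V ⊆ B(H)`. -/
def matrixSpace (V : Submodule ℂ (H →L[ℂ] H)) (F : Type v) [NormedAddCommGroup F]
    [InnerProductSpace ℂ F] [CompleteSpace F] : Submodule ℂ (HTensor H F →L[ℂ] HTensor H F) :=
  ⨅ (d : F) (e : F), V.comap (slice d e)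

theorem mem_matrixSpace {V : Submodule ℂ (H →L[ℂ] H)} {T : HTensor H F →L[ℂ] HTensor H F} :
    T ∈ matrixSpace V F ↔ ∀ d e : F, slice d e T ∈ V := by
  simp [matrixSpace, Submodule.mem_iInf]

/-- The slice map `E^d (·) E_e : V ⊗_M B(F) → V`. -/
def sliceV (V : Submodule ℂ (H →L[ℂ] H)) (d e : F) : matrixSpace V F →ₗ[ℂ] V :=
  (slice d e).restrict fun _ hT => mem_matrixSpace.1 hT d e

theorem adjoint_ketR_htmul (d e : F) (u : H) :
    (ketR H d).adjoint (htmul u e) = ⟪d, e⟫_ℂ • u := by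
  refine ext_inner_left ℂ fun v => ?_
  rw [ContinuousLinearMap.adjoint_inner_right, ketR_apply, inner_htmul, inner_smul_right, mul_comm]

theorem adjoint_ketR_comp_ampl (R : F →L[ℂ] F') (d : F') :
    (ketR H d).adjoint ∘L ampl H R = (ketR H (R.adjoint d)).adjoint := by
  refine HTensor.clm_ext fun u x => ?_
  rw [ContinuousLinearMap.comp_apply, ampl_htmul, adjoint_ketR_htmul, adjoint_ketR_htmul,
    ContinuousLinearMap.adjoint_inner_left]

theorem slice_conj (R : F →L[ℂ] F') (d e : F') (T : HTensor H F →L[ℂ] HTensor H F) :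
    slice d e (ampl H R ∘L T ∘L (ampl H R).adjoint) =
      slice (R.adjoint d) (R.adjoint e) T := by
  have h := congrArg ContinuousLinearMap.adjoint (adjoint_ketR_comp_ampl (H := H) R e)
  rw [ContinuousLinearMap.adjoint_comp, ContinuousLinearMap.adjoint_adjoint,
    ContinuousLinearMap.adjoint_adjoint] at h
  change (ketR H d).adjoint ∘L (ampl H R ∘L T ∘L (ampl H R).adjoint) ∘L ketR H e =
    (ketR H (R.adjoint d)).adjoint ∘L T ∘L ketR H (R.adjoint e)
  rw [← h, ← adjoint_ketR_comp_ampl]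
  rfl

/-- `T ↦ (I ⊗ R) T (I ⊗ R)^*`, from `V ⊗_M B(F)` to `V ⊗_M B(F')`. -/
def conjMap (V : Submodule ℂ (H →L[ℂ] H)) (R : F →L[ℂ] F') :
    matrixSpace V F →ₗ[ℂ] matrixSpace V F' where
  toFun T := ⟨ampl H R ∘L T.1 ∘L (ampl H R).adjoint, mem_matrixSpace.2 fun d e => by
    rw [slice_conj]; exact mem_matrixSpace.1 T.2 _ _⟩
  map_add' S T := by ext; simp
  map_smul' c T := by ext; simp

end MatrixSpaces

section Cocycles

variable {H : Type u} [NormedAddCommGroup H] [InnerProductSpace ℂ H] [CompleteSpace H]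
variable {N : Type v} [NormedAddCommGroup N] [InnerProductSpace ℂ N]

/-- For `d ∈ F_[t,∞[`, the operator `E_d : H ⊗ F_[0,t[ → H ⊗ F`, `ξ ↦ ξ ⊗ d`, under the
identification `F_[0,t[ ⊗ F_[t,∞[ = F`. -/
def ketFuture (H : Type u) [NormedAddCommGroup H] [InnerProductSpace ℂ H] (t : ℝ≥0)
    (d : FockOn N (Set.Ici (t : ℝ))) :
    HTensor H (FockOn N (Set.Ico 0 (t : ℝ))) →L[ℂ] HTensor H (NoiseFock N) :=
  ampl H (fockJoin N t ∘L ketR _ d)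

/-- For an operator `X` on `H ⊗ F = (H ⊗ F_[0,t[) ⊗ F_[t,∞[`, the slice `E^d X E_e` on
`H ⊗ F_[0,t[`, where `d, e ∈ F_[t,∞[`. -/
def sliceFuture (t : ℝ≥0) (d e : FockOn N (Set.Ici (t : ℝ)))
    (X : HTensor H (NoiseFock N) →L[ℂ] HTensor H (NoiseFock N)) :
    HTensor H (FockOn N (Set.Ico 0 (t : ℝ))) →L[ℂ] HTensor H (FockOn N (Set.Ico 0 (t : ℝ))) :=
  (ketFuture H t d).adjoint ∘L X ∘L ketFuture H t e

/-- `X = Y ⊗ I_[t,∞[`, for an operator `Y` on `H ⊗ F_[0,t[`. -/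
def IsAmpliation (t : ℝ≥0) (X : HTensor H (NoiseFock N) →L[ℂ] HTensor H (NoiseFock N))
    (Y : HTensor H (FockOn N (Set.Ico 0 (t : ℝ))) →L[ℂ]
      HTensor H (FockOn N (Set.Ico 0 (t : ℝ)))) : Prop :=
  ∀ d : FockOn N (Set.Ici (t : ℝ)), X ∘L ketFuture H t d = ketFuture H t d ∘L Y

/-- The operator on `H ⊗ F_[0,t[` obtained from `X` by compression with the vacuum of `F_[t,∞[`;
if `X = Y ⊗ I_[t,∞[` this is `Y`. -/
def past (t : ℝ≥0) (X : HTensor H (NoiseFock N) →L[ℂ] HTensor H (NoiseFock N)) :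
    HTensor H (FockOn N (Set.Ico 0 (t : ℝ))) →L[ℂ] HTensor H (FockOn N (Set.Ico 0 (t : ℝ))) :=
  sliceFuture t (expOn 0) (expOn 0) X

theorem inner_ketFuture (t : ℝ≥0) (d e : FockOn N (Set.Ici (t : ℝ)))
    (ξ η : HTensor H (FockOn N (Set.Ico 0 (t : ℝ)))) :
    ⟪ketFuture H t d ξ, ketFuture H t e η⟫_ℂ = ⟪d, e⟫_ℂ * ⟪ξ, η⟫_ℂ := by
  have hJ : ∀ x y : HTensor (FockOn N (Set.Ico 0 (t : ℝ))) (FockOn N (Set.Ici (t : ℝ))),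
      ⟪fockJoin N t x, fockJoin N t y⟫_ℂ = ⟪x, y⟫_ℂ := fun x y =>
    LinearIsometry.inner_map_map
      ⟨(fockJoin N t).toLinearMap, norm_fockJoin t⟩ x y
  refine HTensor.induction ξ (isClosed_eq ((ketFuture H t d).continuous.inner continuous_const)
    (continuous_const.mul (continuous_id.inner continuous_const)))
    (by rw [map_zero, inner_zero_left, inner_zero_left, mul_zero])
    (fun u x => ?_) fun s s' h h' => by
      rw [map_add, inner_add_left, h, h', inner_add_left, mul_add]
  refine HTensor.induction η (isClosed_eq (continuous_const.inner (ketFuture H t e).continuous)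
    (continuous_const.mul (continuous_const.inner continuous_id)))
    (by rw [map_zero, inner_zero_right, inner_zero_right, mul_zero])
    (fun v y => ?_) fun s s' h h' => by
      rw [map_add, inner_add_right, h, h', inner_add_right, mul_add]
  rw [ketFuture, ketFuture, ampl_htmul, ampl_htmul, inner_htmul, inner_htmul,
    ContinuousLinearMap.comp_apply, ContinuousLinearMap.comp_apply, hJ, ketR_apply, ketR_apply,
    inner_htmul]
  ring

theorem IsAmpliation.past_eq {t : ℝ≥0}
    {X : HTensor H (NoiseFock N) →L[ℂ] HTensor H (NoiseFock N)}
    {Y : HTensor H (FockOn N (Set.Ico 0 (t : ℝ))) →L[ℂ] HTensor H (FockOn N (Set.Ico 0 (t : ℝ)))}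
    (h : IsAmpliation t X Y) : past t X = Y := by
  rw [past, sliceFuture, h]
  ext1 ξ
  refine ext_inner_left ℂ fun η => ?_
  rw [ContinuousLinearMap.comp_apply, ContinuousLinearMap.adjoint_inner_right,
    ContinuousLinearMap.comp_apply, inner_ketFuture]
  have h0 : ⟪(expOn 0 : FockOn N (Set.Ici (t : ℝ))), expOn 0⟫_ℂ = 1 :=
    (inner_expOn _ _).trans (by simp)
  rw [h0, one_mul]

/-- A bounded quantum stochastic process on `V`, with noise dimension space `N`: a family of bounded
maps `k_t : V → V ⊗_M B(F)` such that `k_t(a) ∈ V ⊗_M B(F_[0,t[) ⊗ I_[t,∞[`. -/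
def IsQSProcess (V : Submodule ℂ (H →L[ℂ] H))
    (k : ℝ≥0 → V →ₗ[ℂ] matrixSpace V (NoiseFock N)) : Prop :=
  ∀ t : ℝ≥0,
    (∃ C : ℝ, ∀ a : V, ‖k t a‖ ≤ C * ‖a‖) ∧
    ∀ a : V, ∃ Y ∈ matrixSpace V (FockOn N (Set.Ico 0 (t : ℝ))), IsAmpliation t (k t a).1 Y

variable (N) in
/-- The shift `σ_r : V ⊗_M B(F) → V ⊗_M B(F_[r,∞[)`. -/
def sigmaShift (V : Submodule ℂ (H →L[ℂ] H)) (r : ℝ≥0) :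
    matrixSpace V (NoiseFock N) →ₗ[ℂ] matrixSpace V (FockOn N (Set.Ici (r : ℝ))) :=
  conjMap V (fockShift N r)

/-- `S` is the value at `T` of the matrix space lifting `φ' ⊗_M id_{B(F_[r,∞[)}`, where `φ` is
adapted and `φ' : V → V ⊗_M B(F_[0,r[)` is `φ` with the factor `I_[r,∞[` removed, so that
`φ(b) = φ'(b) ⊗ I_[r,∞[`. The lifting is the unique map that satisfies
`E^d (φ' ⊗_M id)(T) E_e = φ'(E^d T E_e)` for all `d, e ∈ F_[r,∞[`. -/
def IsLiftedValue {V : Submodule ℂ (H →L[ℂ] H)} (r : ℝ≥0)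
    (φ : V →ₗ[ℂ] matrixSpace V (NoiseFock N))
    (T : matrixSpace V (FockOn N (Set.Ici (r : ℝ)))) (S : matrixSpace V (NoiseFock N)) : Prop :=
  ∀ d e : FockOn N (Set.Ici (r : ℝ)), sliceFuture r d e S.1 = past r (φ (sliceV V d e T)).1

/-- A (completely bounded) quantum stochastic cocycle on `V`: `k_0(a) = a ⊗ I_F` and
`k_{r+t} = k̂_r ∘ σ_r ∘ k_t`, where `k̂_r = k_r ⊗_M id_{B(F_[r,∞[)}`. -/
def IsQSCocycle (V : Submodule ℂ (H →L[ℂ] H))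
    (k : ℝ≥0 → V →ₗ[ℂ] matrixSpace V (NoiseFock N)) : Prop :=
  IsQSProcess V k ∧
  (∀ t, IsCompletelyBounded (k t)) ∧
  (∀ a : V, (k 0 a).1 = amplR (NoiseFock N) (a : H →L[ℂ] H)) ∧
  ∀ (r t : ℝ≥0) (a : V), IsLiftedValue r (k r) (sigmaShift N V r (k t a)) (k (r + t) a)

/-- The associated semigroup `P^{x,y}_t(a) = E(x_[0,t[)^* k_t(a) E(y_[0,t[)`. -/
def assocMap {V : Submodule ℂ (H →L[ℂ] H)} (k : ℝ≥0 → V →ₗ[ℂ] matrixSpace V (NoiseFock N))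
    (x y : N) (t : ℝ≥0) : V →ₗ[ℂ] V :=
  sliceV V (coh x t) (coh y t) ∘ₗ k t

/-- The Schur-action map `P^𝐱_t = [P^{x_i,x_j}_t]` on `M_n(V)`. -/
def assocSchur {V : Submodule ℂ (H →L[ℂ] H)} (k : ℝ≥0 → V →ₗ[ℂ] matrixSpace V (NoiseFock N))
    {n : ℕ} (x : Fin n → N) (t : ℝ≥0) : matSpace n V →ₗ[ℂ] matSpace n V :=
  schurMap fun i j => assocMap k (x i) (x j) t

/-- The Gram matrix `ϖ^𝐱_t = [⟨ϖ(x_i on [0,t[), ϖ(x_j on [0,t[)⟩]`. -/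
def cohGram {n : ℕ} (x : Fin n → N) (t : ℝ≥0) : Matrix (Fin n) (Fin n) ℂ :=
  Matrix.of fun i j => ⟪coh (x i) t, coh (x j) t⟫_ℂ

theorem cohGram_apply [CompleteSpace N] {n : ℕ} (x : Fin n → N) (t : ℝ≥0) (i j : Fin n) :
    cohGram x t i j =
      Complex.exp (-(t * ((‖x i‖ ^ 2 + ‖x j‖ ^ 2) / 2 - ⟪x i, x j⟫_ℂ))) := by
  have hin : ∀ y z : N, ⟪constOn y t, constOn z t⟫_ℂ = t * ⟪y, z⟫_ℂ := by
    intro y z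
    refine (L2.inner_indicatorConstLp_indicatorConstLp (𝕜 := ℂ) (μ := (volume : Measure ℝ))
      (s := Set.Ico (0 : ℝ) t) (t := Set.Ico (0 : ℝ) t) measurableSet_Ico measurableSet_Ico
      (by simp) (by simp) y z).trans ?_
    simp [Measure.real]
  have hn : ∀ y : N, ((‖constOn y t‖ : ℂ)) ^ 2 = t * (‖y‖ : ℂ) ^ 2 := by
    intro y
    have := hin y y
    rw [inner_self_eq_norm_sq_to_K (𝕜 := ℂ) y] at this
    exact (inner_self_eq_norm_sq_to_K (𝕜 := ℂ) _).symm.trans this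
  change ⟪expOn (constOn (x i) t), expOn (constOn (x j) t)⟫_ℂ = _
  rw [inner_expOn, hn, hn, hin]
  congr 1
  ring

/-- The operator `I ⊗ l` on `Hⁿ`, for a scalar matrix `l`, as an element of `M_n(V)`. -/
def scalarMat {V : Submodule ℂ (H →L[ℂ] H)} (h1 : 1 ∈ V) {n : ℕ} (l : Matrix (Fin n) (Fin n) ℂ) :
    matSpace n V :=
  ⟨ofEntries fun i j => l i j • (1 : H →L[ℂ] H), ofEntries_mem fun _ _ => V.smul_mem _ h1⟩

/-- The all-ones matrix. -/
def boxMat (n : ℕ) : Matrix (Fin n) (Fin n) ℂ := Matrix.of fun _ _ => 1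

end Cocycles
end QSC
end

/-! Everything is tested on slices by coherent vectors. An operator matrix over `H ⊗ F` is positive
as soon as its slices by a total family are, and the exponential vectors of `S`-valued step
functions are total (`dense_span_expOn_stepSet`). On step functions of mesh `h` the cocycle
identity, in the weak form `IsQSCocycle.cohSlice_add`, peels off the first interval: a slice of
`k_{h+s}` is an associated map `P^{x,y}_h` applied to a slice of `k_s`. So a step slice of `k_{mh}`
is an `m`-fold composition of associated maps, applied to a slice of `k_0(a) = a ⊗ I`, which is a
Gram scalar times `a`.

For (a), arrange these slices in a matrix. Each peeling is then a Schur-action map, so positivity is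
inherited from time `0`, where the matrix is the Schur product of a Gram matrix and a positive
matrix (`IsQSCocycle.posMat_cohSlice_step`). Plain positivity of the maps `P^𝐱` is enough because
`n` and the tuple `𝐱` are arbitrary: repeated rows absorb all amplifications. Conversely, slicing by
coherent vectors preserves positivity of matrices.

For (b), a completely positive map on an operator system is contractive exactly when its value at
`1` is at most `1`, by the usual `2 × 2` matrix. The Schur inequalities are slices of `1 - k_t(1) ≥
0` multiplied entrywise by `λ`; the way back is a telescoping version of the induction above
(`IsQSCocycle.posMat_sub_cohSlice_step`), and equalities propagate in the same way. For (c), `1 -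
k_t(1)` is positive, so if its quadratic form vanishes at `v ⊗ ϖ(y_[0,t[)` it annihilates that
vector, and the off-diagonal slices vanish with the diagonal ones.

Totality is the analytic part, since only the span of `S` is dense in `N`. If `∑ c i = 1` then `(∑ c
i * exp (z i / n)) ^ n` tends to `exp (∑ c i * z i)`. Hence the exponential vector of a step
function with affine combinations of the `x i` as values is a limit of combinations of exponential
vectors of finer step functions with values `x i` (`tendsto_affineProd`). As `0 ∈ S`, every linear
combination is affine. Density of step functions and continuity of `ϖ` finish the argument. -/

noncomputable section

namespace QSC

universe u v w

/-! ### Positive operator matrices over arbitrary finite index types -/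

section PosMat

variable {H : Type u} [NormedAddCommGroup H] [InnerProductSpace ℂ H]
variable {ι κ : Type} [Fintype ι] [Fintype κ]

/-- Positivity of a finite operator matrix, as a quadratic form. -/
def PosMat (a : ι → ι → (H →L[ℂ] H)) : Prop :=
  ∀ u : ι → H, 0 ≤ ∑ i, ∑ j, ⟪u i, a i j (u j)⟫_ℂ

/-- By sesquilinearity, vectors carrying the same label may be added up first. This serves both to
repeat rows and columns and to decompose a vector into spanning ones. -/
theorem sum_inner_fiber (a : ι → ι → (H →L[ℂ] H)) (π : κ → ι) [DecidableEq ι] (u : κ → H) :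
    ∑ i, ∑ j, ⟪∑ q with π q = i, u q, a i j (∑ q with π q = j, u q)⟫_ℂ =
      ∑ q, ∑ r, ⟪u q, a (π q) (π r) (u r)⟫_ℂ := by
  have e1 : ∀ i, ∑ j, a i j (∑ q with π q = j, u q) = ∑ r, a i (π r) (u r) := by
    intro i
    rw [← Finset.sum_fiberwise Finset.univ π fun r => a i (π r) (u r)]
    refine Finset.sum_congr rfl fun j _ => ?_
    rw [map_sum]
    refine Finset.sum_congr rfl fun q hq => ?_
    rw [(Finset.mem_filter.1 hq).2]
  simp_rw [← inner_sum, e1]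
  rw [← Finset.sum_fiberwise Finset.univ π fun q => ⟪u q, ∑ r, a (π q) (π r) (u r)⟫_ℂ]
  refine Finset.sum_congr rfl fun i _ => ?_
  rw [sum_inner]
  refine Finset.sum_congr rfl fun q hq => ?_
  rw [(Finset.mem_filter.1 hq).2]

theorem PosMat.pullback {a : ι → ι → (H →L[ℂ] H)} (ha : PosMat a) (π : κ → ι) :
    PosMat fun q r => a (π q) (π r) := by
  classical
  intro u
  rw [← sum_inner_fiber a π u]
  exact ha _

/-- The Schur product of a positive scalar matrix and a positive operator matrix is positive. -/
theorem PosMat.schur {a : ι → ι → (H →L[ℂ] H)} (ha : PosMat a) {l : Matrix ι ι ℂ}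
    (hl : l.PosSemidef) : PosMat fun i j => l i j • a i j := by
  classical
  open scoped MatrixOrder in
  obtain ⟨C, rfl⟩ := CStarAlgebra.nonneg_iff_eq_star_mul_self.1
    (Matrix.nonneg_iff_posSemidef.2 hl)
  intro u
  -- With `l = star C * C` the form splits into one copy of the form of `a` for each row `r` of `C`,
  -- evaluated at the vectors `C r i • u i`.
  have e : ∀ i j, ⟪u i, ((star C * C) i j • a i j) (u j)⟫_ℂ =
      ∑ r, ⟪C r i • u i, a i j (C r j • u j)⟫_ℂ := by
    intro i j
    simp only [Matrix.star_eq_conjTranspose, Matrix.mul_apply, Matrix.conjTranspose_apply,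
      _root_.smul_apply, map_smul, inner_smul_left, inner_smul_right, Finset.sum_mul,
      starRingEnd_apply]
    exact Finset.sum_congr rfl fun r _ => by ring
  simp_rw [e]
  rw [(Finset.sum_congr rfl fun i _ => Finset.sum_comm).trans Finset.sum_comm]
  exact Finset.sum_nonneg fun r _ => ha fun i => C r i • u i

theorem nonneg_iff_inner {T : H →L[ℂ] H} : 0 ≤ T ↔ ∀ z, 0 ≤ ⟪z, T z⟫_ℂ := by
  rw [ContinuousLinearMap.nonneg_iff_isPositive]
  refine ⟨fun h z => h.inner_nonneg_right z, fun h => ?_⟩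
  rw [ContinuousLinearMap.isPositive_iff_complex]
  intro z
  obtain ⟨h1, h2⟩ := Complex.nonneg_iff.1 (h z)
  have h3 : ⟪T z, z⟫_ℂ = ⟪z, T z⟫_ℂ := by
    rw [← inner_conj_symm (T z) z]
    exact Complex.ext (Complex.conj_re _) (by rw [Complex.conj_im, ← h2, neg_zero])
  rw [h3]
  exact ⟨Complex.ext (by simp) (by simp [← h2]), h1⟩

theorem posMat_unit_iff {T : H →L[ℂ] H} : PosMat (fun _ _ : Unit => T) ↔ 0 ≤ T := by
  rw [nonneg_iff_inner]
  exact ⟨fun h z => by simpa using h fun _ => z, fun h u => by simpa using h (u ())⟩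

theorem posMat_const {T : H →L[ℂ] H} (hT : 0 ≤ T) : PosMat (fun _ _ : ι => T) :=
  (posMat_unit_iff.2 hT).pullback fun _ => ()

theorem PosMat.add {a b : ι → ι → (H →L[ℂ] H)} (ha : PosMat a) (hb : PosMat b) :
    PosMat fun i j => a i j + b i j := by
  intro u
  simp only [_root_.add_apply, inner_add_right, Finset.sum_add_distrib]
  exact add_nonneg (ha u) (hb u)

/-- Positivity of an operator matrix may be tested on a total family of vectors that is exhausted
by an increasing sequence of sets. -/
theorem posMat_of_total (b : ι → ι → (H →L[ℂ] H)) (W : ℕ → Set H) (hmono : Monotone W)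
    (hsmul : ∀ p, ∀ (c : ℂ), ∀ w ∈ W p, c • w ∈ W p)
    (hW : Dense (Submodule.span ℂ (⋃ p, W p) : Set H))
    (hb : ∀ p (m : ι → ℕ) (w : (Σ i, Fin (m i)) → H), (∀ q, w q ∈ W p) →
      0 ≤ ∑ q, ∑ r, ⟪w q, b q.1 r.1 (w r)⟫_ℂ) : PosMat b := by
  classical
  have hcl : IsClosed {u : ι → H | 0 ≤ ∑ i, ∑ j, ⟪u i, b i j (u j)⟫_ℂ} := by
    refine isClosed_le continuous_const ?_
    fun_prop
  have hd : Dense (Set.pi Set.univ fun _ : ι => (Submodule.span ℂ (⋃ p, W p) : Set H)) :=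
    dense_pi _ fun _ _ => hW
  intro u
  refine hcl.closure_subset_iff.2 ?_ (hd u)
  intro u hu
  have hmonoS : Monotone fun p => Submodule.span ℂ (W p) :=
    fun p q hpq => Submodule.span_mono (hmono hpq)
  have h1 : ∀ i, ∃ p, u i ∈ Submodule.span ℂ (W p) := by
    intro i
    have := hu i trivial
    rw [SetLike.mem_coe, Submodule.span_iUnion,
      Submodule.mem_iSup_of_directed _ hmonoS.directed_le] at this
    exact this
  choose p hp using h1
  -- Monotonicity puts the finitely many `u i` into the span of a single `W p`, with `p` the largest
  -- level needed; the coefficients are absorbed into the spanning vectors.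
  have h2 : ∀ i, ∃ m : ℕ, ∃ w : Fin m → H,
      (∀ q, w q ∈ W (Finset.univ.sup p)) ∧ ∑ q, w q = u i := by
    intro i
    have := hmonoS (Finset.le_sup (f := p) (Finset.mem_univ i)) (hp i)
    obtain ⟨m, f, g, hg⟩ := Submodule.mem_span_set'.1 this
    exact ⟨m, fun q => f q • (g q : H), fun q => hsmul _ _ _ (g q).2, hg⟩
  choose m w hw hs using h2
  have h3 := hb _ m (fun q => w q.1 q.2) fun q => hw q.1 q.2
  rw [← sum_inner_fiber b (Sigma.fst : (Σ i, Fin (m i)) → ι)] at h3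
  have h4 : ∀ i, ∑ q : (Σ i, Fin (m i)) with q.1 = i, w q.1 q.2 = u i := by
    intro i
    rw [← hs, Finset.sum_filter, Fintype.sum_sigma, Finset.sum_eq_single i]
    · simp
    · intro j _ hj; simp [hj]
    · simp
  simp only [h4] at h3
  exact h3

end PosMat

/-! ### Schur-action maps, complete positivity and `2 × 2` matrices -/

section Matrices

variable {H : Type u} [NormedAddCommGroup H] [InnerProductSpace ℂ H] [CompleteSpace H]
variable {H' : Type v} [NormedAddCommGroup H'] [InnerProductSpace ℂ H'] [CompleteSpace H']
variable {V : Submodule ℂ (H →L[ℂ] H)} {W : Submodule ℂ (H' →L[ℂ] H')}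

theorem inner_ofEntries {n : ℕ} (a : Fin n → Fin n → (H →L[ℂ] H))
    (z w : PiLp 2 (fun _ : Fin n => H)) :
    ⟪z, ofEntries a w⟫_ℂ = ∑ i, ∑ j, ⟪z i, a i j (w j)⟫_ℂ := by
  simp only [PiLp.inner_apply, ofEntries_apply, inner_sum]

theorem ofEntries_nonneg_iff {n : ℕ} {a : Fin n → Fin n → (H →L[ℂ] H)} :
    0 ≤ ofEntries a ↔ PosMat a := by
  rw [nonneg_iff_inner]
  exact ⟨fun h u => by simpa [inner_ofEntries] using h (WithLp.toLp 2 u),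
    fun h z => by rw [inner_ofEntries]; exact h z⟩

theorem ofEntries_entry {n : ℕ}
    (T : PiLp 2 (fun _ : Fin n => H) →L[ℂ] PiLp 2 (fun _ : Fin n => H)) :
    ofEntries (entry T) = T := by
  ext v i
  have hv : v = ∑ j, inj n j (v j) := by
    ext i
    simp [proj_inj]
  rw [ofEntries_apply]
  conv_rhs => rw [hv, map_sum]
  simp [entry]

theorem posMat_entry_iff {n : ℕ}
    {T : PiLp 2 (fun _ : Fin n => H) →L[ℂ] PiLp 2 (fun _ : Fin n => H)} :
    PosMat (entry T) ↔ 0 ≤ T := by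
  rw [← ofEntries_nonneg_iff, ofEntries_entry]

theorem isPositiveMap_schurMap_iff {n : ℕ} {φ : Fin n → Fin n → (V →ₗ[ℂ] W)} :
    IsPositiveMap (schurMap φ) ↔ ∀ a : Fin n → Fin n → V,
      PosMat (fun i j => (a i j : H →L[ℂ] H)) →
        PosMat fun i j => (φ i j (a i j) : H' →L[ℂ] H') := by
  constructor
  · intro h a ha
    have := h ⟨ofEntries fun i j => (a i j : H →L[ℂ] H), ofEntries_mem fun i j => (a i j).2⟩
      (ofEntries_nonneg_iff.2 ha)
    have h2 := ofEntries_nonneg_iff.1 this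
    simpa only [entry_ofEntries] using h2
  · intro h T hT
    exact ofEntries_nonneg_iff.2 (h (fun i j => ⟨entry T.1 i j, T.2 i j⟩) (posMat_entry_iff.2 hT))

/-- Reindexing along `Fintype.equivFin` frees the definition from `Fin n`; products and sigma types
occur as index sets below. -/
theorem IsCompletelyPositive.posMat {ι : Type} [Fintype ι] {φ : V →ₗ[ℂ] W}
    (hφ : IsCompletelyPositive φ) (a : ι → ι → V)
    (ha : PosMat fun i j => (a i j : H →L[ℂ] H)) :
    PosMat fun i j => (φ (a i j) : H' →L[ℂ] H') := by
  have e := Fintype.equivFin ι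
  have h1 := isPositiveMap_schurMap_iff.1 (hφ (Fintype.card ι))
    (fun i j => a (e.symm i) (e.symm j)) (ha.pullback e.symm)
  simpa using h1.pullback e

theorem isCompletelyPositive_of_posMat {φ : V →ₗ[ℂ] W}
    (h : ∀ (n : ℕ) (a : Fin n → Fin n → V), PosMat (fun i j => (a i j : H →L[ℂ] H)) →
      PosMat fun i j => (φ (a i j) : H' →L[ℂ] H')) : IsCompletelyPositive φ :=
  fun n => isPositiveMap_schurMap_iff.2 (h n)

theorem IsCompletelyPositive.isPositiveMap {φ : V →ₗ[ℂ] W} (hφ : IsCompletelyPositive φ) :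
    IsPositiveMap φ := fun a ha =>
  posMat_unit_iff.1 (hφ.posMat (fun _ _ : Unit => a) (posMat_unit_iff.2 ha))

/-- Complete positivity of a Schur-action map from positivity of its amplifications. -/
theorem isCompletelyPositive_schurMap {n : ℕ} {φ : Fin n → Fin n → (V →ₗ[ℂ] W)}
    (h : ∀ (m : ℕ) (a : Fin m × Fin n → Fin m × Fin n → V),
      PosMat (fun p q => (a p q : H →L[ℂ] H)) →
        PosMat fun p q => (φ p.2 q.2 (a p q) : H' →L[ℂ] H')) :
    IsCompletelyPositive (schurMap φ) := by
  refine isCompletelyPositive_of_posMat fun m A hA => ?_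
  -- Rebracketing `M_m(M_n(V))` as matrices indexed by `Fin m × Fin n`.
  have h1 := h m (fun p q => ⟨entry (A p.1 q.1).1 p.2 q.2, (A p.1 q.1).2 _ _⟩) ?_
  · intro U
    have := h1 fun p => U p.1 p.2
    simp only [Fintype.sum_prod_type] at this
    convert this using 2 with i
    rw [Finset.sum_comm]
    refine Finset.sum_congr rfl fun j _ => ?_
    change ⟪U i, ofEntries _ (U j)⟫_ℂ = _
    rw [inner_ofEntries]
  · intro U
    have := hA fun i => WithLp.toLp 2 fun j => U (i, j)
    simp only [Fintype.sum_prod_type]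
    convert this using 2 with i
    rw [Finset.sum_comm]
    refine Finset.sum_congr rfl fun j _ => ?_
    refine (inner_ofEntries (entry (A i j).1) (WithLp.toLp 2 fun l => U (i, l))
      (WithLp.toLp 2 fun l => U (j, l))).symm.trans ?_
    rw [ofEntries_entry]

theorem exists_inner_eq_inner_of_nonneg {T : H →L[ℂ] H} (hT : 0 ≤ T) :
    ∃ R : H →L[ℂ] H, ∀ x y, ⟪x, T y⟫_ℂ = ⟪R x, R y⟫_ℂ := by
  obtain ⟨R, rfl⟩ := CStarAlgebra.nonneg_iff_eq_star_mul_self.1 hT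
  exact ⟨R, fun x y => ContinuousLinearMap.adjoint_inner_right R x (R y)⟩

/-- Off-diagonal entries of a positive `2 × 2` operator matrix with contractive diagonal. -/
theorem norm_le_one_of_posMat {a : Fin 2 → Fin 2 → (H →L[ℂ] H)} (ha : PosMat a)
    (h0 : a 0 0 ≤ 1) (h1 : a 1 1 ≤ 1) : ‖a 0 1‖ ≤ 1 := by
  obtain ⟨R, hR⟩ := exists_inner_eq_inner_of_nonneg (ofEntries_nonneg_iff.2 ha)
  have hin : ∀ i j x y, ⟪R (inj 2 i x), R (inj 2 j y)⟫_ℂ = ⟪x, a i j y⟫_ℂ := by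
    intro i j x y
    rw [← hR, inner_ofEntries, Finset.sum_eq_single i, Finset.sum_eq_single j] <;>
      simp +contextual [proj_inj]
  have hd : ∀ i, a i i ≤ 1 → ∀ z, ‖R (inj 2 i z)‖ ≤ ‖z‖ := by
    intro i hi z
    have := nonneg_iff_inner.1 (sub_nonneg.2 hi) z
    rw [_root_.sub_apply, inner_sub_right, sub_nonneg, ← hin, inner_self_eq_norm_sq_to_K,
      one_apply_eq_self, inner_self_eq_norm_sq_to_K] at this
    have h2 : ‖R (inj 2 i z)‖ ^ 2 ≤ ‖z‖ ^ 2 := by exact_mod_cast this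
    exact (pow_le_pow_iff_left₀ (norm_nonneg _) (norm_nonneg _) two_ne_zero).1 h2
  refine ContinuousLinearMap.opNorm_le_bound _ zero_le_one fun y => ?_
  rw [one_mul]
  -- Cauchy–Schwarz for the form of the matrix gives `‖a 0 1 y‖² ≤ ‖a 0 1 y‖ * ‖y‖`, as `R` is
  -- contractive on each summand.
  have h := (norm_inner_le_norm (𝕜 := ℂ) (R (inj 2 0 (a 0 1 y))) (R (inj 2 1 y))).trans
    (mul_le_mul (hd 0 h0 _) (hd 1 h1 y) (norm_nonneg _) (norm_nonneg _))
  rw [hin, inner_self_eq_norm_sq_to_K, norm_pow, RCLike.norm_ofReal, abs_norm] at h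
  by_contra! hlt
  have h3 : 0 < ‖a 0 1 y‖ := (norm_nonneg _).trans_lt hlt
  nlinarith

/-- Writing `T = R* R`, the hypothesis says `R z = 0`. This is what links off-diagonal slices to
diagonal ones in (c). -/
theorem apply_eq_zero_of_inner_eq_zero {T : H →L[ℂ] H} (hT : 0 ≤ T) {z : H}
    (hz : ⟪z, T z⟫_ℂ = 0) : T z = 0 := by
  obtain ⟨R, hR⟩ := exists_inner_eq_inner_of_nonneg hT
  rw [hR, inner_self_eq_zero] at hz
  refine ext_inner_left ℂ fun x => ?_
  rw [hR, hz, inner_zero_right, inner_zero_right]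

end Matrices

/-! ### Step functions on a uniform mesh -/

section Steps

variable {N : Type v} [NormedAddCommGroup N] [InnerProductSpace ℂ N]

theorem constOn_coeFn (x : N) (t : ℝ≥0) :
    ((constOn x t : L2On N (Set.Ici 0)) : Lp N 2 (volume : Measure ℝ)) =ᵐ[volume]
      (Set.Ico (0 : ℝ) t).indicator fun _ => x :=
  indicatorConstLp_coeFn (hs := measurableSet_Ico) (hμs := by simp)

theorem constOn_add (x y : N) (t : ℝ≥0) : constOn (x + y) t = constOn x t + constOn y t := by
  refine Subtype.ext (Lp.ext ?_)
  filter_upwards [constOn_coeFn (x + y) t, constOn_coeFn x t, constOn_coeFn y t,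
    Lp.coeFn_add (constOn x t : Lp N 2 (volume : Measure ℝ)) (constOn y t)] with s h1 h2 h3 h4
  rw [h1, Submodule.coe_add, h4, Pi.add_apply, h2, h3, Set.indicator_add]

theorem constOn_smul (c : ℂ) (x : N) (t : ℝ≥0) : constOn (c • x) t = c • constOn x t := by
  refine Subtype.ext (Lp.ext ?_)
  filter_upwards [constOn_coeFn (c • x) t, constOn_coeFn x t,
    Lp.coeFn_smul c (constOn x t : Lp N 2 (volume : Measure ℝ))] with s h1 h2 h3
  rw [h1, Submodule.coe_smul, h3, Pi.smul_apply, h2, Set.indicator_const_smul_apply]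

theorem constOn_zero_left (t : ℝ≥0) : constOn (0 : N) t = 0 := by
  rw [← zero_smul ℂ (0 : N), constOn_smul, zero_smul]

theorem constOn_zero_right (x : N) : constOn x 0 = 0 := by
  refine Subtype.ext (Lp.ext ?_)
  filter_upwards [constOn_coeFn x 0, Lp.coeFn_zero N 2 (volume : Measure ℝ)] with s h1 h2
  rw [h1, Submodule.coe_zero, h2]
  simp

theorem inner_constOn [CompleteSpace N] (x y : N) (s t : ℝ≥0) :
    ⟪constOn x s, constOn y t⟫_ℂ = ((min s t : ℝ≥0) : ℝ) * ⟪x, y⟫_ℂ := by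
  refine (L2.inner_indicatorConstLp_indicatorConstLp (𝕜 := ℂ) (μ := (volume : Measure ℝ))
      (s := Set.Ico (0 : ℝ) s) (t := Set.Ico (0 : ℝ) t) measurableSet_Ico measurableSet_Ico
      (by simp) (by simp) x y).trans ?_
  rw [Set.Ico_inter_Ico, max_self, Measure.real, Real.volume_Ico, sub_zero,
    ENNReal.toReal_ofReal (by positivity), NNReal.coe_min, Complex.real_smul]

/-- The shift carries `[0,s[` to `[r,r+s[`, whose indicator is a difference of two indicators of
intervals starting at `0`. -/
theorem embFuture_shiftL2_constOn (x : N) (r s : ℝ≥0) :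
    embFuture N r (shiftL2 N r (constOn x s)) = constOn x (r + s) - constOn x r := by
  refine Subtype.ext (Lp.ext ?_)
  have hp := measurePreserving_sub_right (volume : Measure ℝ) (r : ℝ)
  filter_upwards [constOn_coeFn x (r + s), constOn_coeFn x r,
    Lp.coeFn_sub (constOn x (r + s) : Lp N 2 (volume : Measure ℝ)) (constOn x r),
    Lp.coeFn_compMeasurePreserving (constOn x s : Lp N 2 (volume : Measure ℝ)) hp,
    hp.quasiMeasurePreserving.ae (constOn_coeFn x s)] with q h1 h2 h3 h4 h5
  rw [Submodule.coe_sub, h3, Pi.sub_apply, h1, h2]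
  refine h4.trans (h5.trans ?_)
  have hr := r.2
  have hs := s.2
  simp only [Set.indicator_apply, Set.mem_Ico, NNReal.coe_add]
  by_cases h6 : (r : ℝ) ≤ q
  · have h7 : (0 : ℝ) ≤ q := le_trans hr h6
    simp [h6, h7, sub_lt_iff_lt_add', not_lt.2 h6]
  · by_cases h8 : (0 : ℝ) ≤ q
    · have h9 : q < r + s := by linarith
      simp [h6, h8, h9, not_le.1 h6]
    · simp [h6, h8]

/-- The function equal to `x` on `[jh, (j+1)h[` and to `0` elsewhere. -/
def piece (h : ℝ≥0) (j : ℕ) (x : N) : L2On N (Set.Ici 0) :=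
  constOn x ((j + 1 : ℕ) * h) - constOn x (j * h)

theorem embFuture_shiftL2_piece (h : ℝ≥0) (j : ℕ) (x : N) :
    embFuture N h (shiftL2 N h (piece h j x)) = piece h (j + 1) x := by
  rw [piece, map_sub, map_sub, embFuture_shiftL2_constOn, embFuture_shiftL2_constOn, piece,
    sub_sub_sub_cancel_right]
  congr 2 <;> push_cast <;> ring

theorem inner_piece_self [CompleteSpace N] (h : ℝ≥0) (j : ℕ) (x y : N) :
    ⟪piece h j x, piece h j y⟫_ℂ = (h : ℝ) * ⟪x, y⟫_ℂ := by
  have h1 : (j : ℝ≥0) * h ≤ (j + 1 : ℕ) * h := by gcongr; simp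
  simp only [piece, inner_sub_left, inner_sub_right, inner_constOn, min_self, min_eq_left h1,
    min_eq_right h1]
  push_cast
  ring

/-- Both end points of the earlier interval lie below both of the later one, so every minimum in
`inner_constOn` comes from the earlier interval and the four terms cancel. -/
theorem inner_piece_of_lt [CompleteSpace N] (h : ℝ≥0) {i j : ℕ} (hij : i < j) (x y : N) :
    ⟪piece h i x, piece h j y⟫_ℂ = 0 := by
  have h1 : ((i + 1 : ℕ) : ℝ≥0) * h ≤ j * h := by gcongr; exact hij
  have h2 : (i : ℝ≥0) * h ≤ j * h := by gcongr
  have h3 : ((i + 1 : ℕ) : ℝ≥0) * h ≤ (j + 1 : ℕ) * h := by gcongr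
  have h4 : (i : ℝ≥0) * h ≤ (j + 1 : ℕ) * h := by gcongr; omega
  simp only [piece, inner_sub_left, inner_sub_right, inner_constOn, min_eq_left h1,
    min_eq_left h2, min_eq_left h3, min_eq_left h4]
  ring

theorem inner_piece_of_ne [CompleteSpace N] (h : ℝ≥0) {i j : ℕ} (hij : i ≠ j) (x y : N) :
    ⟪piece h i x, piece h j y⟫_ℂ = 0 := by
  rcases lt_or_gt_of_ne hij with hij | hij
  · exact inner_piece_of_lt h hij x y
  · exact (inner_eq_zero_symm (E := L2On N (Set.Ici 0))).1 (inner_piece_of_lt h hij y x)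

/-- The step function with mesh `h` and values `x 0, …, x (M - 1)`, and `0` afterwards. -/
def step (h : ℝ≥0) (M : ℕ) (x : ℕ → N) : L2On N (Set.Ici 0) :=
  ∑ j ∈ Finset.range M, piece h j (x j)

theorem inner_step [CompleteSpace N] (h : ℝ≥0) (M : ℕ) (x y : ℕ → N) :
    ⟪step h M x, step h M y⟫_ℂ = ∑ j ∈ Finset.range M, (h : ℝ) * ⟪x j, y j⟫_ℂ := by
  rw [step, step, sum_inner]
  refine Finset.sum_congr rfl fun i hi => ?_
  rw [inner_sum, Finset.sum_eq_single_of_mem i hi, inner_piece_self]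
  exact fun j _ hj => inner_piece_of_ne h (Ne.symm hj) _ _

/-- Separates the first interval from a shifted remainder, which is the form of the arguments in the
weak cocycle identity. -/
theorem step_succ (h : ℝ≥0) (M : ℕ) (x : ℕ → N) :
    step h (M + 1) x = constOn (x 0) h +
      embFuture N h (shiftL2 N h (step h M fun j => x (j + 1))) := by
  rw [step, Finset.sum_range_succ', add_comm, step, map_sum, map_sum]
  congr 1
  · simp [piece, constOn_zero_right]
  · exact Finset.sum_congr rfl fun j _ => (embFuture_shiftL2_piece h j _).symm

theorem step_of_le (h : ℝ≥0) {M M' : ℕ} (hM : M ≤ M') (x : ℕ → N) (hx : ∀ j, M ≤ j → x j = 0) :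
    step h M' x = step h M x := by
  refine (Finset.sum_subset (Finset.range_mono hM) fun j _ hj => ?_).symm
  rw [hx j (by simpa using hj), piece, constOn_zero_left, constOn_zero_left, sub_zero]

theorem step_congr (h : ℝ≥0) (M : ℕ) {x y : ℕ → N} (hxy : ∀ j < M, x j = y j) :
    step h M x = step h M y :=
  Finset.sum_congr rfl fun j hj => by rw [hxy j (Finset.mem_range.1 hj)]

theorem sum_piece_add (h : ℝ≥0) (i m : ℕ) (y : N) :
    ∑ l ∈ Finset.range m, piece h (i + l) y = constOn y ((i + m : ℕ) * h) - constOn y (i * h) :=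
  Finset.sum_range_sub (fun l => constOn y ((i + l : ℕ) * h)) m

/-- The fine interval with number `a` lies in the coarse one with number `a / m`, and the `m` fine
pieces inside a coarse interval telescope. -/
theorem step_refine (h : ℝ≥0) (M : ℕ) {m : ℕ} (hm : 0 < m) (y : ℕ → N) :
    step h (M * m) (fun a => y (a / m)) = step (m * h) M y := by
  induction M with
  | zero => simp [step]
  | succ M ih =>
    rw [step, add_mul, one_mul, Finset.sum_range_add, step, Finset.sum_range_succ]
    congr 1
    have e : ∀ l ∈ Finset.range m, piece h (M * m + l) (y ((M * m + l) / m)) =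
        piece h (M * m + l) (y M) := by
      intro l hl
      rw [mul_comm M m, Nat.mul_add_div hm, Nat.div_eq_of_lt (Finset.mem_range.1 hl), add_zero]
    rw [Finset.sum_congr rfl e, sum_piece_add, piece]
    congr 2 <;> push_cast <;> ring

end Steps

/-! ### Coherent slices and the weak cocycle identity -/

section Slices

variable {H : Type u} [NormedAddCommGroup H] [InnerProductSpace ℂ H] [CompleteSpace H]
variable {N : Type v} [NormedAddCommGroup N] [InnerProductSpace ℂ N]
variable {F : Type w} [NormedAddCommGroup F] [InnerProductSpace ℂ F] [CompleteSpace F]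

theorem inner_slice (T : HTensor H F →L[ℂ] HTensor H F) (d e : F) (u v : H) :
    ⟪u, slice d e T v⟫_ℂ = ⟪htmul u d, T (htmul v e)⟫_ℂ :=
  ContinuousLinearMap.adjoint_inner_right (ketR H d) u (T (htmul v e))

theorem slice_one (d e : F) : slice d e (1 : HTensor H F →L[ℂ] HTensor H F) =
    ⟪d, e⟫_ℂ • (1 : H →L[ℂ] H) := by
  refine ContinuousLinearMap.ext fun v => ext_inner_left ℂ fun u => ?_
  rw [inner_slice, _root_.smul_apply, one_apply_eq_self, one_apply_eq_self, inner_htmul,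
    inner_smul_right, mul_comm]

theorem slice_amplR (a : H →L[ℂ] H) (d e : F) : slice d e (amplR F a) = ⟪d, e⟫_ℂ • a := by
  refine ContinuousLinearMap.ext fun v => ext_inner_left ℂ fun u => ?_
  rw [inner_slice, _root_.smul_apply, amplR_htmul, inner_htmul, inner_smul_right, mul_comm]

theorem ketFuture_htmul (t : ℝ≥0) (d : FockOn N (Set.Ici (t : ℝ))) (u : H)
    (x : FockOn N (Set.Ico 0 (t : ℝ))) :
    ketFuture H t d (htmul u x) = htmul u (fockJoin N t (htmul x d)) := by
  rw [ketFuture, ampl_htmul]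
  rfl

/-- Slicing the future and then the past is slicing with the joint vector. -/
theorem slice_sliceFuture (t : ℝ≥0) (d e : FockOn N (Set.Ici (t : ℝ)))
    (x y : FockOn N (Set.Ico 0 (t : ℝ)))
    (X : HTensor H (NoiseFock N) →L[ℂ] HTensor H (NoiseFock N)) :
    slice x y (sliceFuture t d e X) =
      slice (fockJoin N t (htmul x d)) (fockJoin N t (htmul y e)) X := by
  refine ContinuousLinearMap.ext fun v => ext_inner_left ℂ fun u => ?_
  rw [inner_slice, inner_slice, ← ketFuture_htmul, ← ketFuture_htmul]
  exact ContinuousLinearMap.adjoint_inner_right (ketFuture H t d) _ _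

/-- The past part of a constant function. -/
theorem exists_embPast_eq_constOn (x : N) (t : ℝ≥0) :
    ∃ f : L2On N (Set.Ico 0 (t : ℝ)), embPast N t f = constOn x t := by
  refine ⟨⟨(constOn x t : Lp N 2 (volume : Measure ℝ)), ?_⟩, rfl⟩
  filter_upwards [constOn_coeFn x t] with s h hs
  rw [h, Set.indicator_of_notMem hs]

theorem adjoint_fockShift_expOn (r : ℝ≥0) (f : L2On N (Set.Ici 0)) :
    (fockShift N r).adjoint (expOn (shiftL2 N r f)) = expOn f := by
  refine ext_inner_left ℂ fun z => ?_
  rw [ContinuousLinearMap.adjoint_inner_right, ← fockShift_expOn]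
  exact LinearIsometry.inner_map_map ⟨(fockShift N r).toLinearMap, norm_fockShift r⟩ z (expOn f)

variable {V : Submodule ℂ (H →L[ℂ] H)} {k : ℝ≥0 → V →ₗ[ℂ] matrixSpace V (NoiseFock N)}

/-- The slice of `k_t(a)` by the coherent vectors of `f` and `g`. -/
def cohSlice (k : ℝ≥0 → V →ₗ[ℂ] matrixSpace V (NoiseFock N)) (f g : L2On N (Set.Ici 0)) (t : ℝ≥0) :
    V →ₗ[ℂ] V :=
  sliceV V (expOn f) (expOn g) ∘ₗ k t

theorem coe_cohSlice (f g : L2On N (Set.Ici 0)) (t : ℝ≥0) (a : V) :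
    (cohSlice k f g t a : H →L[ℂ] H) = slice (expOn f) (expOn g) (k t a).1 := rfl

theorem IsQSCocycle.cohSlice_zero (hk : IsQSCocycle V k) (f g : L2On N (Set.Ici 0)) (a : V) :
    (cohSlice k f g 0 a : H →L[ℂ] H) = ⟪expOn f, expOn g⟫_ℂ • (a : H →L[ℂ] H) := by
  rw [coe_cohSlice, hk.2.2.1, slice_amplR]

/-- The weak form of the cocycle identity. -/
theorem IsQSCocycle.cohSlice_add (hk : IsQSCocycle V k) (x y : N) (f g : L2On N (Set.Ici 0))
    (r s : ℝ≥0) (a : V) :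
    cohSlice k (constOn x r + embFuture N r (shiftL2 N r f))
        (constOn y r + embFuture N r (shiftL2 N r g)) (r + s) a =
      assocMap k x y r (cohSlice k f g s a) := by
  obtain ⟨p, hp⟩ := exists_embPast_eq_constOn x r
  obtain ⟨q, hq⟩ := exists_embPast_eq_constOn y r
  refine Subtype.ext ?_
  -- Slicing the lifting by shifted coherent vectors in the future undoes `σ_r`, leaving `k r`
  -- applied to a slice of `k s a`.
  have h := hk.2.2.2 r s a (expOn (shiftL2 N r f)) (expOn (shiftL2 N r g))
  have hb : sliceV V (expOn (shiftL2 N r f)) (expOn (shiftL2 N r g)) (sigmaShift N V r (k s a)) =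
      cohSlice k f g s a := by
    refine Subtype.ext ((slice_conj (fockShift N r) _ _ _).trans ?_)
    rw [adjoint_fockShift_expOn, adjoint_fockShift_expOn]
    rfl
  rw [hb] at h
  -- Slicing the past too: on the left the past and future functions join; on the right the vacuum
  -- in `past` adds nothing, which leaves the vectors defining `assocMap`.
  have h2 := congrArg (slice (expOn p) (expOn q)) h
  rw [past, slice_sliceFuture, slice_sliceFuture, fockJoin_htmul, fockJoin_htmul, fockJoin_htmul,
    fockJoin_htmul, map_zero, add_zero, add_zero, hp, hq] at h2
  exact h2

end Slices

/-! ### Exponential vectors of affine combinations as limits -/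

section Totality

open Filter Topology

/-- A weak form of the exponential limit for affine combinations of exponentials. -/
theorem tendsto_sum_mul_exp_pow {ι : Type*} [Fintype ι] (c z : ι → ℂ) (hc : ∑ i, c i = 1) :
    Tendsto (fun n : ℕ => (∑ i, c i * Complex.exp (z i / n)) ^ n) atTop
      (𝓝 (Complex.exp (∑ i, c i * z i))) := by
  -- The derivative of `exp (s * w)` at `0`, along `s = 1 / n`. As the weights sum to `1`, the base
  -- of the power is `1 + ∑ c i * (exp (z i / n) - 1)`.
  have h1 : ∀ w : ℂ, Tendsto (fun n : ℕ => (n : ℂ) * (Complex.exp (w / n) - 1)) atTop (𝓝 w) := by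
    intro w
    have hd : HasDerivAt (fun s : ℂ => Complex.exp (s * w)) w 0 := by
      simpa using ((hasDerivAt_id (0 : ℂ)).mul_const w).cexp
    have ht := hd.tendsto_slope_zero
    have hn : Tendsto (fun n : ℕ => ((n : ℂ))⁻¹) atTop (𝓝[≠] 0) := by
      refine tendsto_nhdsWithin_iff.2 ⟨tendsto_inv_atTop_nhds_zero_nat, ?_⟩
      filter_upwards [eventually_ne_atTop 0] with n hn
      simpa using hn
    refine (ht.comp hn).congr fun n => ?_
    simp [div_eq_inv_mul]
  have h2 : Tendsto (fun n : ℕ => (n : ℂ) * ∑ i, c i * (Complex.exp (z i / n) - 1)) atTop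
      (𝓝 (∑ i, c i * z i)) := by
    have := tendsto_finsetSum Finset.univ fun i _ => (h1 (z i)).const_mul (c i)
    refine this.congr fun n => ?_
    rw [Finset.mul_sum]
    exact Finset.sum_congr rfl fun i _ => by ring
  refine (Complex.tendsto_one_add_pow_exp_of_tendsto h2).congr fun n => ?_
  congr 1
  simp only [mul_sub, mul_one, Finset.sum_sub_distrib, hc]
  ring

/-- Expand `‖v n - e‖²`. Norm convergence of coherent vectors thereby reduces to limits of explicit
scalar exponentials. -/
theorem tendsto_of_tendsto_inner {E : Type*} [NormedAddCommGroup E] [InnerProductSpace ℂ E]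
    {v : ℕ → E} {e : E} (h1 : Tendsto (fun n => ⟪v n, v n⟫_ℂ) atTop (𝓝 ⟪e, e⟫_ℂ))
    (h2 : Tendsto (fun n => ⟪v n, e⟫_ℂ) atTop (𝓝 ⟪e, e⟫_ℂ)) : Tendsto v atTop (𝓝 e) := by
  have h3 : Tendsto (fun n => ⟪e, v n⟫_ℂ) atTop (𝓝 ⟪e, e⟫_ℂ) := by
    have := (Complex.continuous_conj.tendsto _).comp h2
    rw [inner_conj_symm] at this
    exact this.congr fun n => inner_conj_symm _ _
  have h4 : Tendsto (fun n => ‖⟪v n - e, v n - e⟫_ℂ‖) atTop (𝓝 0) := by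
    have := (((h1.sub h2).sub h3).add_const ⟪e, e⟫_ℂ).norm
    rw [sub_self, zero_sub, neg_add_cancel, norm_zero] at this
    refine this.congr fun n => ?_
    rw [inner_sub_left, inner_sub_right, inner_sub_right]
    congr 1
    ring
  rw [tendsto_iff_norm_sub_tendsto_zero]
  have h5 : Tendsto (fun n => ‖v n - e‖ ^ 2) atTop (𝓝 0) :=
    h4.congr fun n => by
      rw [inner_self_eq_norm_sq_to_K, norm_pow, RCLike.norm_ofReal, abs_norm]
  simpa using h5.sqrt

theorem inner_sum_smul_left {E : Type*} [NormedAddCommGroup E] [InnerProductSpace ℂ E]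
    {κ : Type*} (s : Finset κ) (c : κ → ℂ) (v : κ → E) (w : E) :
    ⟪∑ i ∈ s, c i • v i, w⟫_ℂ = ∑ i ∈ s, (starRingEnd ℂ) (c i) * ⟪v i, w⟫_ℂ := by
  simp only [sum_inner, inner_smul_left]

theorem inner_sum_smul_right {E : Type*} [NormedAddCommGroup E] [InnerProductSpace ℂ E]
    {κ : Type*} (s : Finset κ) (c : κ → ℂ) (v : κ → E) (w : E) :
    ⟪w, ∑ i ∈ s, c i • v i⟫_ℂ = ∑ i ∈ s, c i * ⟪w, v i⟫_ℂ := by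
  simp only [inner_sum, inner_smul_right]

theorem inner_smul_smul {E : Type*} [NormedAddCommGroup E] [InnerProductSpace ℂ E]
    (c d : ℂ) (v w : E) : ⟪c • v, d • w⟫_ℂ = (starRingEnd ℂ) c * d * ⟪v, w⟫_ℂ := by
  rw [inner_smul_left, inner_smul_right, mul_assoc]

variable {N : Type v} [NormedAddCommGroup N] [InnerProductSpace ℂ N]

/-- The (unnormalised) exponential vector. -/
def expFree {J : Set ℝ} (f : L2On N J) : FockOn N J :=
  ((Real.exp (‖f‖ ^ 2 / 2) : ℝ) : ℂ) • expOn f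

/-- Without normalisation the inner product turns sums over disjoint intervals into plain products.
-/
theorem inner_expFree {J : Set ℝ} (f g : L2On N J) :
    ⟪expFree f, expFree g⟫_ℂ = Complex.exp ⟪f, g⟫_ℂ := by
  refine (inner_smul_smul _ _ (expOn f) (expOn g)).trans ?_
  rw [inner_expOn, Complex.conj_ofReal,
    Complex.ofReal_exp, Complex.ofReal_exp, ← Complex.exp_add, ← Complex.exp_add]
  congr 1
  push_cast
  ring

theorem expFree_mem_iff {J : Set ℝ} {D : Submodule ℂ (FockOn N J)} {f : L2On N J} :
    expFree f ∈ D ↔ expOn f ∈ D :=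
  D.smul_mem_iff (by exact_mod_cast (Real.exp_pos _).ne')

theorem continuous_expOn {J : Set ℝ} : Continuous (expOn : L2On N J → FockOn N J) := by
  refine continuous_iff_continuousAt.2 fun f => tendsto_iff_seq_tendsto.2 fun u hu => ?_
  refine tendsto_of_tendsto_inner ?_ ?_
  · simp only [Function.comp_def, inner_expOn]
    have e : ∀ g : L2On N J, ⟪g, g⟫_ℂ = (‖g‖ : ℂ) ^ 2 := fun g => inner_self_eq_norm_sq_to_K g
    simp [e]
  · simp only [Function.comp_def, inner_expOn]
    have h1 := hu.norm
    have h2 : Tendsto (fun n => ⟪u n, f⟫_ℂ) atTop (𝓝 ⟪f, f⟫_ℂ) := hu.inner tendsto_const_nhds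
    refine (Complex.continuous_exp.tendsto _).comp (Tendsto.neg (Tendsto.sub ?_ h2))
    exact (((((Complex.continuous_ofReal.tendsto _).comp h1).pow 2).add_const _).div_const _)

theorem prod_range_mul_div (M : ℕ) {m : ℕ} (hm : 0 < m) (G : ℕ → ℂ) :
    ∏ a ∈ Finset.range (M * m), G (a / m) = ∏ j ∈ Finset.range M, G j ^ m := by
  induction M with
  | zero => simp
  | succ M ih =>
    rw [add_mul, one_mul, Finset.prod_range_add, ih, Finset.prod_range_succ]
    congr 1
    rw [Finset.prod_congr rfl (g := fun _ => G M), Finset.prod_const, Finset.card_range]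
    intro l hl
    rw [mul_comm M m, Nat.mul_add_div hm, Nat.div_eq_of_lt (Finset.mem_range.1 hl), add_zero]

variable {ι : Type w} [Fintype ι]

/-- Extension of a finite word to an infinite sequence. -/
def extendWord (i₀ : ι) {n : ℕ} (φ : Fin n → ι) (a : ℕ) : ι :=
  if h : a < n then φ ⟨a, h⟩ else i₀

/-- A product of affine combinations of exponential vectors on consecutive short intervals. -/
def affineProd (x : ι → N) (c : ℕ → ι → ℂ) (i₀ : ι) (h : ℝ≥0) (n : ℕ) : NoiseFock N :=
  ∑ φ : Fin n → ι, (∏ a : Fin n, c a (φ a)) • expFree (step h n fun a => x (extendWord i₀ φ a))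

theorem inner_expFree_step_extendWord [CompleteSpace N] (x : ι → N) (i₀ : ι) (h : ℝ≥0) {n : ℕ}
    (φ : Fin n → ι) (w : ℕ → N) :
    ⟪expFree (step h n fun a => x (extendWord i₀ φ a)), expFree (step h n w)⟫_ℂ =
      ∏ a : Fin n, Complex.exp ((h : ℝ) * ⟪x (φ a), w a⟫_ℂ) := by
  rw [inner_expFree, inner_step, Finset.sum_range, Complex.exp_sum]
  simp [extendWord]

/-- Each word contributes a product over the intervals, so the sum over all words is an expanded
product of sums, one factor per interval. -/
theorem inner_affineProd_step [CompleteSpace N] (x : ι → N) (c : ℕ → ι → ℂ) (i₀ : ι) (h : ℝ≥0)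
    (n : ℕ) (w : ℕ → N) :
    ⟪affineProd x c i₀ h n, expFree (step h n w)⟫_ℂ =
      ∏ a : Fin n, ∑ i, (starRingEnd ℂ) (c a i) * Complex.exp ((h : ℝ) * ⟪x i, w a⟫_ℂ) := by
  classical
  refine (inner_sum_smul_left _ _ _ _).trans ?_
  rw [Finset.prod_univ_sum, Fintype.piFinset_univ]
  refine Finset.sum_congr rfl fun φ _ => ?_
  rw [inner_expFree_step_extendWord, map_prod, Finset.prod_mul_distrib]

theorem inner_affineProd_self [CompleteSpace N] (x : ι → N) (c : ℕ → ι → ℂ) (i₀ : ι) (h : ℝ≥0)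
    (n : ℕ) :
    ⟪affineProd x c i₀ h n, affineProd x c i₀ h n⟫_ℂ =
      ∏ a : Fin n, ∑ p : ι × ι, (c a p.1 * (starRingEnd ℂ) (c a p.2)) *
        Complex.exp ((h : ℝ) * ⟪x p.2, x p.1⟫_ℂ) := by
  classical
  have e : ∀ a : Fin n, ∑ p : ι × ι, (c a p.1 * (starRingEnd ℂ) (c a p.2)) *
        Complex.exp ((h : ℝ) * ⟪x p.2, x p.1⟫_ℂ) = ∑ k, c a k *
        ∑ i, (starRingEnd ℂ) (c a i) * Complex.exp ((h : ℝ) * ⟪x i, x k⟫_ℂ) := by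
    intro a
    rw [Fintype.sum_prod_type]
    refine Finset.sum_congr rfl fun k _ => ?_
    rw [Finset.mul_sum]
    exact Finset.sum_congr rfl fun i _ => by ring
  simp_rw [e]
  refine (inner_sum_smul_right _ _ _ _).trans ?_
  rw [Finset.prod_univ_sum, Fintype.piFinset_univ]
  refine Finset.sum_congr rfl fun ψ _ => ?_
  rw [Finset.prod_mul_distrib]
  congr 1
  refine (inner_affineProd_step x c i₀ h n _).trans ?_
  simp [extendWord]

/-- The exponential vector of a step function whose values are affine combinations of the `x i` is
a limit of linear combinations of exponential vectors of finer step functions with values `x i`. -/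
theorem tendsto_affineProd [CompleteSpace N] (x : ι → N) (c : ℕ → ι → ℂ) (hc : ∀ j, ∑ i, c j i = 1)
    (i₀ : ι) (h : ℝ≥0) (M : ℕ) :
    Tendsto (fun m : ℕ => affineProd x (fun a => c (a / m)) i₀ (h / m) (M * m)) atTop
      (𝓝 (expFree (step h M fun j => ∑ i, c j i • x i))) := by
  set y : ℕ → N := fun j => ∑ i, c j i • x i with hy
  have hself : ⟪expFree (step h M y), expFree (step h M y)⟫_ℂ =
      ∏ j ∈ Finset.range M, Complex.exp ((h : ℝ) * ⟪y j, y j⟫_ℂ) := by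
    rw [inner_expFree, inner_step, Complex.exp_sum]
  have hdiv : ∀ (m : ℕ) (z : ℂ), (((h / m : ℝ≥0) : ℝ) : ℂ) * z = (h : ℝ) * z / m := by
    intro m z
    push_cast
    ring
  have hstep : ∀ m : ℕ, 0 < m → step h M y = step (h / m) (M * m) fun a => y (a / m) := by
    intro m hm
    rw [step_refine _ _ hm, mul_div_cancel₀ _ (by exact_mod_cast hm.ne')]
  refine tendsto_of_tendsto_inner ?_ ?_
  · rw [hself]
    have ht : Tendsto (fun m : ℕ => ∏ j ∈ Finset.range M,
        (∑ p : ι × ι, (c j p.1 * (starRingEnd ℂ) (c j p.2)) *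
          Complex.exp ((h : ℝ) * ⟪x p.2, x p.1⟫_ℂ / m)) ^ m) atTop
        (𝓝 (∏ j ∈ Finset.range M, Complex.exp ((h : ℝ) * ⟪y j, y j⟫_ℂ))) := by
      refine tendsto_finsetProd _ fun j _ => ?_
      -- The products of weights again sum to `1`, being the product of `∑ c` and its conjugate; the
      -- limiting exponent is `h * ⟪y j, y j⟫`.
      have := tendsto_sum_mul_exp_pow (fun p : ι × ι => c j p.1 * (starRingEnd ℂ) (c j p.2))
        (fun p => (h : ℝ) * ⟪x p.2, x p.1⟫_ℂ) ?_
      · convert this using 3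
        simp only [hy, sum_inner, inner_sum, inner_smul_left, inner_smul_right, Finset.mul_sum,
          Fintype.sum_prod_type]
        exact Finset.sum_congr rfl fun k _ => Finset.sum_congr rfl fun i _ => by ring
      · rw [Fintype.sum_prod_type]
        simp only [← Finset.mul_sum, ← map_sum, hc]
        simp [hc]
    refine ht.congr' ?_
    filter_upwards [eventually_gt_atTop 0] with m hm
    rw [inner_affineProd_self, ← prod_range_mul_div M hm fun j => ∑ p : ι × ι,
      (c j p.1 * (starRingEnd ℂ) (c j p.2)) * Complex.exp ((h : ℝ) * ⟪x p.2, x p.1⟫_ℂ / m),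
      Finset.prod_range]
    simp only [hdiv]
  · rw [hself]
    have ht : Tendsto (fun m : ℕ => ∏ j ∈ Finset.range M,
        (∑ i, (starRingEnd ℂ) (c j i) * Complex.exp ((h : ℝ) * ⟪x i, y j⟫_ℂ / m)) ^ m) atTop
        (𝓝 (∏ j ∈ Finset.range M, Complex.exp ((h : ℝ) * ⟪y j, y j⟫_ℂ))) := by
      refine tendsto_finsetProd _ fun j _ => ?_
      have := tendsto_sum_mul_exp_pow (fun i => (starRingEnd ℂ) (c j i))
        (fun i => (h : ℝ) * ⟪x i, y j⟫_ℂ) (by rw [← map_sum, hc, map_one])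
      convert this using 3
      conv_lhs => rw [hy]
      simp only [sum_inner, inner_smul_left, Finset.mul_sum]
      exact Finset.sum_congr rfl fun i _ => by ring
    refine ht.congr' ?_
    filter_upwards [eventually_gt_atTop 0] with m hm
    -- The limit function is rewritten on the fine mesh, so that both arguments share it; each
    -- coarse interval then gives an `m`-th power.
    rw [hstep m hm, inner_affineProd_step, ← prod_range_mul_div M hm fun j =>
      ∑ i, (starRingEnd ℂ) (c j i) * Complex.exp ((h : ℝ) * ⟪x i, y j⟫_ℂ / m),
      Finset.prod_range]
    simp only [hdiv]

end Totality

/-! ### Totality of the exponential vectors of `S`-valued step functions -/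

section StepSets

open Filter Topology

variable {N : Type v} [NormedAddCommGroup N] [InnerProductSpace ℂ N]

/-- It is the kernel of restriction to the complement of `J`. The resulting completeness permits
density to be proved by orthogonality. -/
theorem isClosed_L2On {J : Set ℝ} (hJ : MeasurableSet J) :
    IsClosed (L2On N J : Set (Lp N 2 (volume : Measure ℝ))) := by
  have h : (L2On N J : Set (Lp N 2 (volume : Measure ℝ))) =
      LinearMap.ker (LpToLpRestrictCLM ℝ N ℂ (volume : Measure ℝ) 2 Jᶜ).toLinearMap := by
    ext f
    change (∀ᵐ s, s ∉ J → f s = 0) ↔ LpToLpRestrictCLM ℝ N ℂ (volume : Measure ℝ) 2 Jᶜ f = 0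
    rw [Lp.eq_zero_iff_ae_eq_zero]
    have h1 := LpToLpRestrictCLM_coeFn (p := 2) (μ := (volume : Measure ℝ)) ℂ Jᶜ f
    have h2 := ae_restrict_iff' (μ := (volume : Measure ℝ)) (p := fun s => f s = 0) hJ.compl
    constructor
    · intro hf
      exact h1.trans (h2.2 hf)
    · intro hf
      exact h2.1 (h1.symm.trans hf)
  rw [h]
  exact (LpToLpRestrictCLM ℝ N ℂ (volume : Measure ℝ) 2 Jᶜ).isClosed_ker

instance completeSpace_L2On_Ici (a : ℝ) [CompleteSpace N] : CompleteSpace (L2On N (Set.Ici a)) :=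
  (isClosed_L2On measurableSet_Ici).completeSpace_coe

/-- The primitive is continuous and vanishes at the dyadic multiples of `τ`, hence on the half-line;
Lebesgue differentiation recovers `f` almost everywhere. -/
theorem eq_zero_of_integral_dyadic [CompleteSpace N] {τ : ℝ≥0} (hτ : 0 < τ)
    (f : L2On N (Set.Ici 0))
    (hf : ∀ p j : ℕ, ∫ s in Set.Ico (0 : ℝ) ((j * (τ / 2 ^ p) : ℝ≥0) : ℝ),
      (f : Lp N 2 (volume : Measure ℝ)) s = 0) : f = 0 := by
  have hloc : LocallyIntegrable (f : Lp N 2 (volume : Measure ℝ)) volume :=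
    (Lp.memLp (f : Lp N 2 (volume : Measure ℝ))).locallyIntegrable (by norm_num)
  have hint : ∀ a b : ℝ, IntervalIntegrable (f : Lp N 2 (volume : Measure ℝ)) volume a b :=
    fun a b => intervalIntegrable_iff.mpr <|
      (hloc.integrableOn_isCompact isCompact_uIcc).mono_set Set.uIoc_subset_uIcc
  set G : ℝ → N := fun s => ∫ t in (0 : ℝ)..s, (f : Lp N 2 (volume : Measure ℝ)) t with hG
  have hcont : Continuous G := intervalIntegral.continuous_primitive hint 0
  have hdy : ∀ p j : ℕ, G ((j * (τ / 2 ^ p) : ℝ≥0) : ℝ) = 0 := by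
    intro p j
    rw [hG]
    change ∫ t in (0 : ℝ)..((j * (τ / 2 ^ p) : ℝ≥0) : ℝ), (f : Lp N 2 (volume : Measure ℝ)) t = 0
    rw [intervalIntegral.integral_of_le (NNReal.coe_nonneg _), ← integral_Ico_eq_integral_Ioc, hf]
  have hτ' : (0 : ℝ) < τ := by exact_mod_cast hτ
  have hzero : ∀ s : ℝ, 0 ≤ s → G s = 0 := by
    intro s hs
    -- Approximation of `s` from below by mesh points of level `p`.
    have h1 : Tendsto (fun p : ℕ => (⌊s / τ * (2 : ℝ) ^ p⌋₊ : ℝ) / 2 ^ p * τ) atTop (𝓝 s) := by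
      have h2 := ((tendsto_nat_floor_mul_div_atTop (R := ℝ) (a := s / τ) (by positivity)).comp
        (tendsto_pow_atTop_atTop_of_one_lt (r := (2 : ℝ)) one_lt_two)).mul_const (τ : ℝ)
      rwa [div_mul_cancel₀ _ hτ'.ne'] at h2
    refine tendsto_nhds_unique ((hcont.tendsto s).comp h1) (tendsto_const_nhds.congr fun p => ?_)
    rw [Function.comp_apply, ← hdy p ⌊s / τ * (2 : ℝ) ^ p⌋₊]
    congr 1
    push_cast
    ring
  refine Subtype.ext ((Lp.eq_zero_iff_ae_eq_zero).2 ?_)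
  have hne : ∀ᵐ s : ℝ, s ≠ 0 := by
    rw [ae_iff]; simp
  filter_upwards [LocallyIntegrable.ae_hasDerivAt_integral hloc, hne, f.2] with s h1 h2 h3
  rcases lt_or_gt_of_ne h2 with hs | hs
  · exact h3 (by simpa using hs)
  · refine (h1 0).unique ?_
    refine (hasDerivAt_const s (0 : N)).congr_of_eventuallyEq ?_
    filter_upwards [lt_mem_nhds hs] with q hq
    exact hzero q hq.le

theorem inner_constOn_left [CompleteSpace N] (x : N) (t : ℝ≥0) (f : L2On N (Set.Ici 0)) :
    ⟪constOn x t, f⟫_ℂ =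
      ⟪x, ∫ s in Set.Ico (0 : ℝ) t, (f : Lp N 2 (volume : Measure ℝ)) s⟫_ℂ :=
  L2.inner_indicatorConstLp_eq_inner_setIntegral ℂ measurableSet_Ico (by simp) x f.1

/-- The step functions with mesh `h` and values in `U`. -/
def stepSet (U : Set N) (h : ℝ≥0) : Set (L2On N (Set.Ici 0)) :=
  {f | ∃ (M : ℕ) (x : ℕ → N), (∀ j, x j ∈ U) ∧ f = step h M x}

theorem stepSet_subset_div {U : Set N} (h : ℝ≥0) : stepSet U h ⊆ stepSet U (h / 2) := by
  rintro f ⟨M, x, hx, rfl⟩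
  refine ⟨M * 2, fun a => x (a / 2), fun a => hx _, ?_⟩
  rw [step_refine _ _ two_pos]
  congr 1
  push_cast
  rw [mul_div_cancel₀ _ two_ne_zero]

theorem stepSet_mono (U : Set N) (τ : ℝ≥0) : Monotone fun p : ℕ => stepSet U (τ / 2 ^ p) :=
  monotone_nat_of_le_succ fun p => by
    have := stepSet_subset_div (U := U) (τ / 2 ^ p)
    rwa [div_div, ← pow_succ] at this

/-- Padding with the value `0 ∈ U`, so that finitely many step functions can be given the same
number of intervals. -/
theorem exists_step_of_mem_stepSet {U : Set N} (h0 : 0 ∈ U) {h : ℝ≥0} {f : L2On N (Set.Ici 0)}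
    (hf : f ∈ stepSet U h) :
    ∃ M₀, ∀ M, M₀ ≤ M → ∃ x : ℕ → N, (∀ j, x j ∈ U) ∧ f = step h M x := by
  obtain ⟨M₀, x, hx, rfl⟩ := hf
  refine ⟨M₀, fun M hM => ⟨fun j => if j < M₀ then x j else 0, fun j => ?_, ?_⟩⟩
  · dsimp only; split_ifs
    exacts [hx j, h0]
  · rw [step_of_le h hM _ fun j hj => if_neg (not_lt.2 hj)]
    exact step_congr h M₀ fun j hj => (if_pos hj).symm

theorem piece_add (h : ℝ≥0) (j : ℕ) (x y : N) : piece h j (x + y) = piece h j x + piece h j y := by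
  rw [piece, piece, piece, constOn_add, constOn_add]; abel

theorem piece_smul (h : ℝ≥0) (j : ℕ) (c : ℂ) (x : N) : piece h j (c • x) = c • piece h j x := by
  rw [piece, piece, constOn_smul, constOn_smul, smul_sub]

/-- The step functions on dyadic subdivisions of mesh `τ` with values in a subspace. -/
def stepSubmodule (U : Submodule ℂ N) (τ : ℝ≥0) : Submodule ℂ (L2On N (Set.Ici 0)) where
  carrier := ⋃ p : ℕ, stepSet (U : Set N) (τ / 2 ^ p)
  zero_mem' := Set.mem_iUnion.2 ⟨0, 0, fun _ => 0, fun _ => U.zero_mem, by simp [step]⟩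
  add_mem' := by
    intro f g hf hg
    obtain ⟨p, hp⟩ := Set.mem_iUnion.1 hf
    obtain ⟨q, hq⟩ := Set.mem_iUnion.1 hg
    obtain ⟨M₁, h₁⟩ := exists_step_of_mem_stepSet U.zero_mem
      (stepSet_mono (U : Set N) τ (le_max_left p q) hp)
    obtain ⟨M₂, h₂⟩ := exists_step_of_mem_stepSet U.zero_mem
      (stepSet_mono (U : Set N) τ (le_max_right p q) hq)
    obtain ⟨x, hx, rfl⟩ := h₁ _ (le_max_left M₁ M₂)
    obtain ⟨y, hy, rfl⟩ := h₂ _ (le_max_right M₁ M₂)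
    refine Set.mem_iUnion.2 ⟨max p q, max M₁ M₂, fun j => x j + y j,
      fun j => U.add_mem (hx j) (hy j), ?_⟩
    rw [step, step, step, ← Finset.sum_add_distrib]
    exact Finset.sum_congr rfl fun j _ => (piece_add _ _ _ _).symm
  smul_mem' := by
    intro c f hf
    obtain ⟨p, M, x, hx, rfl⟩ := Set.mem_iUnion.1 hf
    refine Set.mem_iUnion.2 ⟨p, M, fun j => c • x j, fun j => U.smul_mem c (hx j), ?_⟩
    rw [step, step, Finset.smul_sum]
    exact Finset.sum_congr rfl fun j _ => (piece_smul _ _ _ _).symm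

theorem constOn_mem_stepSubmodule {U : Submodule ℂ N} (τ : ℝ≥0) {x : N} (hx : x ∈ U) (p j : ℕ) :
    constOn x (j * (τ / 2 ^ p)) ∈ stepSubmodule U τ := by
  refine Set.mem_iUnion.2 ⟨p, j, fun _ => x, fun _ => hx, ?_⟩
  have := sum_piece_add (τ / 2 ^ p) 0 j x
  simp only [zero_add, Nat.cast_zero, zero_mul, constOn_zero_right, sub_zero] at this
  exact this.symm

theorem dense_stepSubmodule [CompleteSpace N] {U : Submodule ℂ N} (hU : Dense (U : Set N))
    {τ : ℝ≥0} (hτ : 0 < τ) : Dense (stepSubmodule U τ : Set (L2On N (Set.Ici 0))) := by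
  rw [Submodule.dense_iff_topologicalClosure_eq_top, Submodule.topologicalClosure_eq_top_iff,
    Submodule.eq_bot_iff]
  intro f hf
  refine eq_zero_of_integral_dyadic hτ f fun p j => ?_
  refine hU.eq_zero_of_inner_right ℂ fun x hx => ?_
  rw [← inner_constOn_left]
  exact (Submodule.mem_orthogonal _ _).1 hf _ (constOn_mem_stepSubmodule τ hx p j)

/-- A closed subspace that contains the exponential vectors of the step functions with values in
`S ∋ 0` contains those of the step functions with values in the span of `S`. -/
theorem expOn_step_mem_of_span [CompleteSpace N] {S : Set N} (h0 : (0 : N) ∈ S) (τ : ℝ≥0)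
    {D : Submodule ℂ (NoiseFock N)} (hD : IsClosed (D : Set (NoiseFock N)))
    (hS : ∀ p, ∀ f ∈ stepSet S (τ / 2 ^ p), expOn f ∈ D) (p : ℕ) {f : L2On N (Set.Ici 0)}
    (hf : f ∈ stepSet (Submodule.span ℂ S : Set N) (τ / 2 ^ p)) : expOn f ∈ D := by
  classical
  obtain ⟨M, y, hy, rfl⟩ := hf
  choose s hsS hs using fun j => Submodule.mem_span_finite_of_mem_span (hy j)
  set s' : Finset N := (Finset.range M).biUnion s with hs'
  have hs'S : ∀ v ∈ s', v ∈ S := by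
    intro v hv
    obtain ⟨j, _, hj⟩ := Finset.mem_biUnion.1 hv
    exact hsS j hj
  have hd : ∀ j, ∃ d : s' → ℂ, j < M → ∑ v, d v • (v : N) = y j := by
    intro j
    by_cases hj : j < M
    · have h1 : y j ∈ Submodule.span ℂ (Set.range fun v : s' => (v : N)) := by
        refine Submodule.span_mono ?_ (hs j)
        intro v hv
        exact ⟨⟨v, Finset.mem_biUnion.2 ⟨j, Finset.mem_range.2 hj, hv⟩⟩, rfl⟩
      obtain ⟨d, hd⟩ := (Submodule.mem_span_range_iff_exists_fun ℂ).1 h1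
      exact ⟨d, fun _ => hd⟩
    · exact ⟨0, fun h => absurd h hj⟩
  choose d hd using hd
  -- The extra index `none` carries the vector `0 ∈ S` with weight `1 - ∑ v, d j v`, which makes the
  -- combination affine without changing its value.
  have ht := tendsto_affineProd (ι := Option s') (fun i => i.elim 0 fun v => (v : N))
    (fun j i => i.elim (1 - ∑ v, d j v) (d j)) (fun j => by simp [Fintype.sum_option]) none
    (τ / 2 ^ p) M
  have hy' : step (τ / 2 ^ p) M (fun j => ∑ i : Option s',
      i.elim (1 - ∑ v, d j v) (d j) • i.elim (0 : N) fun v => (v : N)) = step (τ / 2 ^ p) M y :=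
    step_congr _ _ fun j hj => by simpa [Fintype.sum_option] using hd j hj
  rw [hy'] at ht
  rw [← expFree_mem_iff]
  -- Only the subdivisions `m = 2 ^ q` are kept: the refined mesh is then `τ / 2 ^ (p + q)`, again
  -- dyadic.
  refine hD.mem_of_tendsto (ht.comp (tendsto_pow_atTop_atTop_of_one_lt (r := 2) one_lt_two))
    (Eventually.of_forall fun q => ?_)
  refine D.sum_mem fun φ _ => D.smul_mem _ (expFree_mem_iff.2 (hS (p + q) _ ?_))
  rw [pow_add, ← div_div]
  refine ⟨_, _, fun j => ?_, by norm_cast⟩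
  rcases extendWord none φ j with _ | v
  · exact h0
  · exact hs'S v v.2

/-- If `S ∋ 0` is total, then the exponential vectors of the `S`-valued dyadic step functions are
total in the Fock space. -/
theorem dense_span_expOn_stepSet [CompleteSpace N] {S : Set N} (h0 : (0 : N) ∈ S)
    (hS : (Submodule.span ℂ S).topologicalClosure = ⊤) {τ : ℝ≥0} (hτ : 0 < τ) :
    Dense (Submodule.span ℂ (⋃ p : ℕ, expOn '' stepSet S (τ / 2 ^ p)) : Set (NoiseFock N)) := by
  set D := (Submodule.span ℂ (⋃ p : ℕ, expOn '' stepSet S (τ / 2 ^ p))).topologicalClosure with hD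
  have hDc : IsClosed (D : Set (NoiseFock N)) := Submodule.isClosed_topologicalClosure _
  have h1 : ∀ p, ∀ f ∈ stepSet S (τ / 2 ^ p), expOn f ∈ D := fun p f hf =>
    Submodule.le_topologicalClosure _
      (Submodule.subset_span (Set.mem_iUnion.2 ⟨p, f, hf, rfl⟩))
  -- Step functions with values in the span of `S` are dense, and `expOn` is continuous.
  have h2 : ∀ f : L2On N (Set.Ici 0), expOn f ∈ D := by
    intro f
    refine (hDc.preimage continuous_expOn).closure_subset_iff.2 ?_
      (dense_stepSubmodule (Submodule.dense_iff_topologicalClosure_eq_top.2 hS) hτ f)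
    intro g hg
    obtain ⟨p, hp⟩ := Set.mem_iUnion.1 hg
    exact expOn_step_mem_of_span h0 τ hDc h1 p hp
  rw [Submodule.dense_iff_topologicalClosure_eq_top, ← hD, eq_top_iff,
    ← Submodule.dense_iff_topologicalClosure_eq_top.1 (dense_span_expOn (N := N))]
  refine Submodule.topologicalClosure_minimal _ (Submodule.span_le.2 ?_) hDc
  rintro _ ⟨f, rfl⟩
  exact h2 f

end StepSets

/-! ### Testing operator matrices on step slices -/

section SliceMatrices

variable {H : Type u} [NormedAddCommGroup H] [InnerProductSpace ℂ H] [CompleteSpace H]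
variable {F : Type w} [NormedAddCommGroup F] [InnerProductSpace ℂ F] [CompleteSpace F]
variable {ι κ : Type} [Fintype ι] [Fintype κ]

theorem PosMat.slice {b : ι → ι → (HTensor H F →L[ℂ] HTensor H F)} (hb : PosMat b) (d : ι → F) :
    PosMat fun i j => QSC.slice (d i) (d j) (b i j) := by
  intro u
  simp only [inner_slice]
  exact hb fun i => htmul (u i) (d i)

variable {N : Type v} [NormedAddCommGroup N] [InnerProductSpace ℂ N] [CompleteSpace N]

/-- Positivity of an operator matrix over `H ⊗ F` may be tested on slices by exponential vectors of
step functions. -/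
theorem posMat_of_slice {S : Set N} (h0 : (0 : N) ∈ S)
    (hS : (Submodule.span ℂ S).topologicalClosure = ⊤) {τ : ℝ≥0} (hτ : 0 < τ)
    {b : ι → ι → (HTensor H (NoiseFock N) →L[ℂ] HTensor H (NoiseFock N))}
    (hb : ∀ (p : ℕ) (m : ι → ℕ) (f : (Σ i, Fin (m i)) → L2On N (Set.Ici 0)),
      (∀ q, f q ∈ stepSet S (τ / 2 ^ p)) →
        PosMat fun q r => slice (expOn (f q)) (expOn (f r)) (b q.1 r.1)) : PosMat b := by
  refine posMat_of_total b
    (fun p => {w | ∃ u : H, ∃ f ∈ stepSet S (τ / 2 ^ p), w = htmul u (expOn f)}) ?_ ?_ ?_ ?_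
  · rintro p q hpq w ⟨u, f, hf, rfl⟩
    exact ⟨u, f, stepSet_mono S τ hpq hf, rfl⟩
  · rintro p c w ⟨u, f, hf, rfl⟩
    refine ⟨c • u, f, hf, ?_⟩
    have := smul_htmul_smul c 1 u (expOn f)
    rw [one_smul, mul_one] at this
    exact this.symm
  · have hd := dense_span_htmul (id : H → H)
      (Subtype.val : (⋃ p : ℕ, expOn '' stepSet S (τ / 2 ^ p)) → NoiseFock N) (by simp)
      (by rw [Subtype.range_coe]; exact dense_span_expOn_stepSet h0 hS hτ)
    refine hd.mono (Submodule.span_mono ?_)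
    rintro _ ⟨⟨u, ⟨e, he⟩⟩, rfl⟩
    obtain ⟨p, f, hf, rfl⟩ := Set.mem_iUnion.1 he
    exact Set.mem_iUnion.2 ⟨p, u, f, hf, rfl⟩
  · intro p m w hw
    choose u f hf hwe using hw
    have := hb p m f hf u
    simpa only [inner_slice, ← hwe] using this

/-- Taking `τ = t` makes `t` a mesh point at every dyadic level; for `t = 0` any positive `τ` does.
-/
theorem exists_mesh (t : ℝ≥0) : ∃ τ : ℝ≥0, 0 < τ ∧ ∀ p : ℕ, ∃ m : ℕ, t = m * (τ / 2 ^ p) := by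
  rcases eq_or_ne t 0 with rfl | ht
  · exact ⟨1, one_pos, fun p => ⟨0, by simp⟩⟩
  · refine ⟨t, pos_iff_ne_zero.2 ht, fun p => ⟨2 ^ p, ?_⟩⟩
    push_cast
    rw [mul_div_cancel₀ _ (by positivity)]

/-- The form `M + m` guarantees at least `m` intervals, so that an induction on `m` can peel off one
for each mesh step of the time. -/
theorem exists_common_step {S : Set N} (h0 : (0 : N) ∈ S) {h : ℝ≥0}
    {f : κ → L2On N (Set.Ici 0)} (hf : ∀ q, f q ∈ stepSet S h) (m : ℕ) :
    ∃ (M : ℕ) (x : κ → ℕ → N), (∀ q j, x q j ∈ S) ∧ ∀ q, f q = step h (M + m) (x q) := by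
  choose M₀ hM₀ using fun q => exists_step_of_mem_stepSet h0 (hf q)
  choose x hx hfx using fun q =>
    hM₀ q (Finset.univ.sup M₀ + m) ((Finset.le_sup (Finset.mem_univ q)).trans (Nat.le_add_right _ _))
  exact ⟨_, x, hx, hfx⟩

theorem inner_expOn_self {J : Set ℝ} (f : L2On N J) : ⟪expOn f, expOn f⟫_ℂ = 1 := by
  rw [inner_expOn, inner_self_eq_norm_sq_to_K (𝕜 := ℂ) (E := L2On N J)]
  simp

/-- Both vectors factor as past tensor future under the isometric identification, and the shift
preserves inner products. This is the scalar counterpart of `IsQSCocycle.cohSlice_add`. -/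
theorem inner_expOn_constOn_add (x y : N) (r : ℝ≥0) (f g : L2On N (Set.Ici 0)) :
    ⟪expOn (constOn x r + embFuture N r (shiftL2 N r f)),
        expOn (constOn y r + embFuture N r (shiftL2 N r g))⟫_ℂ =
      ⟪coh x r, coh y r⟫_ℂ * ⟪expOn f, expOn g⟫_ℂ := by
  obtain ⟨p, hp⟩ := exists_embPast_eq_constOn x r
  obtain ⟨q, hq⟩ := exists_embPast_eq_constOn y r
  have h1 : ⟪expOn p, expOn q⟫_ℂ = ⟪coh x r, coh y r⟫_ℂ := by
    rw [coh, coh, ← hp, ← hq]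
    refine (inner_expOn p q).trans (Eq.trans ?_ (inner_expOn _ _).symm)
    rw [(embPast N r).norm_map, (embPast N r).norm_map]
    rfl
  have h2 : ⟪expOn (shiftL2 N r f), expOn (shiftL2 N r g)⟫_ℂ = ⟪expOn f, expOn g⟫_ℂ := by
    rw [← fockShift_expOn, ← fockShift_expOn]
    exact LinearIsometry.inner_map_map ⟨(fockShift N r).toLinearMap, norm_fockShift r⟩ _ _
  rw [← h1, ← h2, ← hp, ← hq, ← fockJoin_htmul, ← fockJoin_htmul, ← inner_htmul]
  exact LinearIsometry.inner_map_map ⟨(fockJoin N r).toLinearMap, norm_fockJoin r⟩ _ _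

theorem posSemidef_inner {E : Type*} [NormedAddCommGroup E] [InnerProductSpace ℂ E] (d : ι → E) :
    (Matrix.of fun i j => ⟪d i, d j⟫_ℂ).PosSemidef :=
  Matrix.posSemidef_gram ℂ d

end SliceMatrices

/-! ### Propagation along the mesh, contractivity and unitality -/

section Positivity

variable {H : Type u} [NormedAddCommGroup H] [InnerProductSpace ℂ H] [CompleteSpace H]
variable {N : Type v} [NormedAddCommGroup N] [InnerProductSpace ℂ N] [CompleteSpace N]
variable {V : Submodule ℂ (H →L[ℂ] H)} {k : ℝ≥0 → V →ₗ[ℂ] matrixSpace V (NoiseFock N)}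
variable {κ : Type} [Fintype κ]

theorem isCompletelyPositive_assocSchur {t : ℝ≥0} (hk : IsCompletelyPositive (k t)) {n : ℕ}
    (x : Fin n → N) : IsCompletelyPositive (assocSchur k x t) :=
  isCompletelyPositive_schurMap fun _ a ha => (hk.posMat a ha).slice fun p => coh (x p.2) t

theorem posMat_assocMap {x : κ → N} {t : ℝ≥0}
    (h : ∀ (n : ℕ) (π : Fin n → κ), IsPositiveMap (assocSchur k (fun i => x (π i)) t))
    (a : κ → κ → V) (ha : PosMat fun q r => (a q r : H →L[ℂ] H)) :
    PosMat fun q r => (assocMap k (x q) (x r) t (a q r) : H →L[ℂ] H) := by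
  have e := Fintype.equivFin κ
  have h1 := isPositiveMap_schurMap_iff.1 (h _ e.symm) (fun i j => a (e.symm i) (e.symm j))
    (ha.pullback e.symm)
  simpa using h1.pullback e

/-- Positivity of the associated semigroups propagates to slices by step functions. -/
theorem IsQSCocycle.posMat_cohSlice_step (hk : IsQSCocycle V k) {S : Set N} {h : ℝ≥0}
    (hP : ∀ (n : ℕ) (x : Fin n → N), (∀ i, x i ∈ S) → IsPositiveMap (assocSchur k x h))
    (a : κ → κ → V) (ha : PosMat fun q r => (a q r : H →L[ℂ] H)) (M m : ℕ) (x : κ → ℕ → N)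
    (hx : ∀ q j, x q j ∈ S) :
    PosMat fun q r => (cohSlice k (step h (M + m) (x q)) (step h (M + m) (x r)) (m * h) (a q r) :
      H →L[ℂ] H) := by
  induction m generalizing x with
  | zero =>
    -- At time `0` the slices form the Schur product of `a` with the Gram matrix of the coherent
    -- vectors.
    simp only [Nat.cast_zero, zero_mul, hk.cohSlice_zero]
    exact ha.schur (posSemidef_inner fun q => expOn (step h (M + 0) (x q)))
  | succ m ih =>
    have e : ((m + 1 : ℕ) : ℝ≥0) * h = h + m * h := by push_cast; ring
    rw [e]
    simp only [← add_assoc, step_succ, hk.cohSlice_add]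
    exact posMat_assocMap (x := fun q => x q 0) (fun n π => hP n _ fun i => hx _ _) _
      (ih (fun q j => x q (j + 1)) fun q j => hx q _)

/-- A cocycle is completely positive if its associated Schur-action semigroups are positive. -/
theorem IsQSCocycle.isCompletelyPositive (hk : IsQSCocycle V k) {S : Set N} (h0 : (0 : N) ∈ S)
    (hS : (Submodule.span ℂ S).topologicalClosure = ⊤)
    (hP : ∀ (n : ℕ) (x : Fin n → N), (∀ i, x i ∈ S) → ∀ t, IsPositiveMap (assocSchur k x t))
    (t : ℝ≥0) : IsCompletelyPositive (k t) := by
  refine isCompletelyPositive_of_posMat fun n a ha => ?_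
  obtain ⟨τ, hτ, hm⟩ := exists_mesh t
  refine posMat_of_slice (b := fun i j => (k t (a i j)).1) h0 hS hτ fun p l f hf => ?_
  obtain ⟨m, rfl⟩ := hm p
  obtain ⟨M, x, hx, hfx⟩ := exists_common_step h0 hf m
  have ha' : PosMat fun q r : (Σ i, Fin (l i)) => (a q.1 r.1 : H →L[ℂ] H) :=
    ha.pullback fun q : (Σ i, Fin (l i)) => q.1
  have hP' : ∀ (n : ℕ) (x : Fin n → N), (∀ i, x i ∈ S) →
      IsPositiveMap (assocSchur k x (τ / 2 ^ p)) := fun n x hx => hP n x hx _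
  have h2 := hk.posMat_cohSlice_step (κ := Σ i, Fin (l i)) (S := S) (h := τ / 2 ^ p) hP'
    (fun q r => a q.1 r.1) ha' M m x hx
  simp only [hfx]
  exact h2

variable (h1 : 1 ∈ V)

theorem coe_assocMap_one (x y : N) (t : ℝ≥0) :
    (assocMap k x y t ⟨1, h1⟩ : H →L[ℂ] H) = slice (coh x t) (coh y t) (k t ⟨1, h1⟩).1 := rfl

theorem coe_assocSchur_scalarMat {n : ℕ} (x : Fin n → N) (t : ℝ≥0) (l : Matrix (Fin n) (Fin n) ℂ) :
    (assocSchur k x t (scalarMat h1 l)).1 =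
      ofEntries fun i j => l i j • (assocMap k (x i) (x j) t ⟨1, h1⟩ : H →L[ℂ] H) := by
  change ofEntries _ = _
  congr 1
  funext i j
  have e : (⟨entry (scalarMat h1 l).1 i j, (scalarMat h1 l).2 i j⟩ : V) = l i j • ⟨1, h1⟩ :=
    Subtype.ext (entry_ofEntries _ i j)
  rw [e, map_smul]
  rfl

theorem assocSchur_scalarMat_le_iff {n : ℕ} (x : Fin n → N) (t : ℝ≥0)
    (l g : Matrix (Fin n) (Fin n) ℂ) :
    (assocSchur k x t (scalarMat h1 l)).1 ≤ (scalarMat h1 g).1 ↔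
      PosMat fun i j => g i j • (1 : H →L[ℂ] H) -
        l i j • (assocMap k (x i) (x j) t ⟨1, h1⟩ : H →L[ℂ] H) := by
  rw [← sub_nonneg, coe_assocSchur_scalarMat, ← ofEntries_nonneg_iff]
  have e : (scalarMat h1 g).1 -
      ofEntries (fun i j => l i j • (assocMap k (x i) (x j) t ⟨1, h1⟩ : H →L[ℂ] H)) =
      ofEntries fun i j => g i j • (1 : H →L[ℂ] H) -
        l i j • (assocMap k (x i) (x j) t ⟨1, h1⟩ : H →L[ℂ] H) := by
    rw [sub_eq_iff_eq_add, ← ofEntries_add]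
    simp [scalarMat]
  rw [e]

theorem assocSchur_scalarMat_eq_iff {n : ℕ} (x : Fin n → N) (t : ℝ≥0)
    (l g : Matrix (Fin n) (Fin n) ℂ) :
    assocSchur k x t (scalarMat h1 l) = scalarMat h1 g ↔
      ∀ i j, l i j • (assocMap k (x i) (x j) t ⟨1, h1⟩ : H →L[ℂ] H) = g i j • 1 := by
  rw [Subtype.ext_iff, coe_assocSchur_scalarMat]
  constructor
  · intro h i j
    have := congrArg (fun T => entry T i j) h
    simpa [scalarMat, entry_ofEntries] using this
  · intro h
    simp only [h]
    rfl

/-- Let `G` be the Gram matrix and `Q` the matrix of slices of `k(1)` for the remainders after the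
first interval, and let `P` be the Schur action of that interval, with Gram matrix `ϖ`. Then `(ϖ ∘
G) 1 - P(Q) = P(G 1 - Q) + G ∘ (ϖ 1 - P(1))`. The first term is positive by induction and positivity
of `P`, the second by the Schur product theorem. -/
theorem IsQSCocycle.posMat_sub_cohSlice_step (hk : IsQSCocycle V k) {S : Set N} {h : ℝ≥0}
    (hP : IsCompletelyPositive (k h))
    (hQ : ∀ (n : ℕ) (x : Fin n → N), (∀ i, x i ∈ S) →
      PosMat fun i j => ⟪coh (x i) h, coh (x j) h⟫_ℂ • (1 : H →L[ℂ] H) -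
        (assocMap k (x i) (x j) h ⟨1, h1⟩ : H →L[ℂ] H))
    (M m : ℕ) (x : κ → ℕ → N) (hx : ∀ q j, x q j ∈ S) :
    PosMat fun q r =>
      ⟪expOn (step h (M + m) (x q)), expOn (step h (M + m) (x r))⟫_ℂ • (1 : H →L[ℂ] H) -
        (cohSlice k (step h (M + m) (x q)) (step h (M + m) (x r)) (m * h) ⟨1, h1⟩ :
          H →L[ℂ] H) := by
  induction m generalizing x with
  | zero =>
    simp only [Nat.cast_zero, zero_mul, hk.cohSlice_zero, sub_self]
    intro u
    simp
  | succ m ih =>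
    have e : ((m + 1 : ℕ) : ℝ≥0) * h = h + m * h := by push_cast; ring
    rw [e]
    simp only [← add_assoc, step_succ, hk.cohSlice_add, inner_expOn_constOn_add]
    set f : κ → L2On N (Set.Ici 0) := fun q => step h (M + m) fun j => x q (j + 1) with hf
    have hi := ih (fun q j => x q (j + 1)) fun q j => hx q _
    have hi' : PosMat fun q r => ((⟪expOn (f q), expOn (f r)⟫_ℂ • (⟨1, h1⟩ : V) -
        cohSlice k (f q) (f r) (m * h) ⟨1, h1⟩ : V) : H →L[ℂ] H) := by
      simp only [Submodule.coe_sub, Submodule.coe_smul]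
      exact hi
    have hA := posMat_assocMap (k := k) (t := h) (x := fun q => x q 0)
      (fun n π => (isCompletelyPositive_assocSchur hP _).isPositiveMap) _ hi'
    have hB : PosMat fun q r => ⟪coh (x q 0) h, coh (x r 0) h⟫_ℂ • (1 : H →L[ℂ] H) -
        (assocMap k (x q 0) (x r 0) h ⟨1, h1⟩ : H →L[ℂ] H) := by
      have e := Fintype.equivFin κ
      simpa using (hQ _ (fun i => x (e.symm i) 0) fun i => hx _ _).pullback e
    have hC := hA.add (hB.schur (posSemidef_inner fun q => expOn (f q)))
    convert hC using 3 with q r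
    rw [map_sub, map_smul, Submodule.coe_sub, Submodule.coe_smul, Matrix.of_apply, smul_sub,
      smul_smul, mul_comm]
    abel

/-- The same peeling with equalities: each interval contributes its scalar `⟪coh x h, coh y h⟫`, so
one pair of step functions can be treated at a time. -/
theorem IsQSCocycle.cohSlice_step_one (hk : IsQSCocycle V k) {S : Set N} {h : ℝ≥0}
    (hQ : ∀ x ∈ S, ∀ y ∈ S,
      (assocMap k x y h ⟨1, h1⟩ : H →L[ℂ] H) = ⟪coh x h, coh y h⟫_ℂ • (1 : H →L[ℂ] H))
    (M m : ℕ) (x y : ℕ → N) (hx : ∀ j, x j ∈ S) (hy : ∀ j, y j ∈ S) :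
    cohSlice k (step h (M + m) x) (step h (M + m) y) (m * h) ⟨1, h1⟩ =
      ⟪expOn (step h (M + m) x), expOn (step h (M + m) y)⟫_ℂ • (⟨1, h1⟩ : V) := by
  induction m generalizing x y with
  | zero =>
    rw [Nat.cast_zero, zero_mul]
    exact Subtype.ext (hk.cohSlice_zero _ _ _)
  | succ m ih =>
    have e : ((m + 1 : ℕ) : ℝ≥0) * h = h + m * h := by push_cast; ring
    rw [e, ← add_assoc, step_succ, step_succ, hk.cohSlice_add, inner_expOn_constOn_add,
      ih _ _ (fun j => hx _) fun j => hy _, map_smul, mul_comm, mul_smul]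
    congr 1
    exact Subtype.ext (hQ _ (hx 0) _ (hy 0))

/-- `k_t(1) ≤ 1` if this holds for the associated semigroups, in the Schur sense. -/
theorem IsQSCocycle.apply_one_le_one (hk : IsQSCocycle V k) {S : Set N} (h0 : (0 : N) ∈ S)
    (hS : (Submodule.span ℂ S).topologicalClosure = ⊤) (hP : ∀ t, IsCompletelyPositive (k t))
    (hQ : ∀ (n : ℕ) (x : Fin n → N), (∀ i, x i ∈ S) → ∀ t,
      PosMat fun i j => ⟪coh (x i) t, coh (x j) t⟫_ℂ • (1 : H →L[ℂ] H) -
        (assocMap k (x i) (x j) t ⟨1, h1⟩ : H →L[ℂ] H)) (t : ℝ≥0) :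
    (k t ⟨1, h1⟩).1 ≤ 1 := by
  rw [← sub_nonneg, ← posMat_unit_iff]
  obtain ⟨τ, hτ, hm⟩ := exists_mesh t
  refine posMat_of_slice h0 hS hτ fun p l f hf => ?_
  obtain ⟨m, rfl⟩ := hm p
  obtain ⟨M, x, hx, hfx⟩ := exists_common_step h0 hf m
  simp only [hfx, map_sub, slice_one]
  exact hk.posMat_sub_cohSlice_step h1 (hP _) (fun n x hx => hQ n x hx _) M m x hx

/-- `k_t(1) = 1` if this holds for the associated semigroups. -/
theorem IsQSCocycle.apply_one_eq_one (hk : IsQSCocycle V k) {S : Set N} (h0 : (0 : N) ∈ S)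
    (hS : (Submodule.span ℂ S).topologicalClosure = ⊤)
    (hQ : ∀ x ∈ S, ∀ y ∈ S, ∀ t,
      (assocMap k x y t ⟨1, h1⟩ : H →L[ℂ] H) = ⟪coh x t, coh y t⟫_ℂ • (1 : H →L[ℂ] H))
    (t : ℝ≥0) : (k t ⟨1, h1⟩).1 = 1 := by
  obtain ⟨τ, hτ, hm⟩ := exists_mesh t
  have key : ∀ (p : ℕ) (l : Unit → ℕ) (f : (Σ i, Fin (l i)) → L2On N (Set.Ici 0)),
      (∀ q, f q ∈ stepSet S (τ / 2 ^ p)) → ∀ q r,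
        slice (expOn (f q)) (expOn (f r)) (k t ⟨1, h1⟩).1 =
          slice (expOn (f q)) (expOn (f r)) 1 := by
    intro p l f hf q r
    obtain ⟨m, rfl⟩ := hm p
    obtain ⟨M, x, hx, hfx⟩ := exists_common_step h0 hf m
    rw [hfx, hfx, slice_one]
    exact congrArg Subtype.val (hk.cohSlice_step_one h1 (fun x hx y hy => hQ x hx y hy _) M m
      (x q) (x r) (hx q) (hx r))
  -- The slice test detects positivity, so equality is read off from two inequalities, in each of
  -- which all the slices vanish.
  refine le_antisymm ?_ ?_ <;> rw [← sub_nonneg, ← posMat_unit_iff] <;>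
    refine posMat_of_slice h0 hS hτ fun p l f hf => ?_ <;>
    simp only [map_sub, key p l f hf, sub_self] <;>
    intro u <;> simp

theorem apply_one_le_one_of_contractive {t : ℝ≥0} (hP : IsCompletelyPositive (k t))
    (hc : IsContractiveMap (k t)) : (k t ⟨1, h1⟩).1 ≤ 1 := by
  have hpos : 0 ≤ (k t ⟨1, h1⟩).1 := hP.isPositiveMap ⟨1, h1⟩ zero_le_one
  have hnorm : ‖(k t ⟨1, h1⟩).1‖ ≤ 1 := (hc ⟨1, h1⟩).trans ContinuousLinearMap.norm_id_le
  rw [← sub_nonneg, nonneg_iff_inner]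
  intro z
  rw [_root_.sub_apply, inner_sub_right, one_apply_eq_self]
  have h2 := Complex.nonneg_iff.1 (nonneg_iff_inner.1 hpos z)
  have h3 : ⟪z, z⟫_ℂ = ((‖z‖ ^ 2 : ℝ) : ℂ) := by
    rw [inner_self_eq_norm_sq_to_K]; push_cast; rfl
  rw [h3, Complex.nonneg_iff, Complex.sub_re, Complex.sub_im, Complex.ofReal_re, Complex.ofReal_im]
  refine ⟨sub_nonneg.2 ?_, by rw [← h2.2, sub_zero]⟩
  calc (⟪z, (k t ⟨1, h1⟩).1 z⟫_ℂ).re ≤ ‖⟪z, (k t ⟨1, h1⟩).1 z⟫_ℂ‖ := Complex.re_le_norm _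
    _ ≤ ‖z‖ * ‖(k t ⟨1, h1⟩).1 z‖ := norm_inner_le_norm _ _
    _ ≤ ‖z‖ * (1 * ‖z‖) := by gcongr; exact ContinuousLinearMap.le_of_opNorm_le _ hnorm z
    _ = ‖z‖ ^ 2 := by ring

/-- The quadratic form is `‖u 0‖² + ‖u 1‖² + 2 Re ⟪u 0, a (u 1)⟫`, which is at least `(‖u 0‖ - ‖u
1‖)²`. -/
theorem posMat_two_of_norm_le_one {a : H →L[ℂ] H} (ha : ‖a‖ ≤ 1)
    {A : Fin 2 → Fin 2 → (H →L[ℂ] H)} (h00 : A 0 0 = 1) (h01 : A 0 1 = a) (h10 : A 1 0 = star a)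
    (h11 : A 1 1 = 1) : PosMat A := by
  intro u
  have h3 : ∀ z : H, ⟪z, z⟫_ℂ = ((‖z‖ ^ 2 : ℝ) : ℂ) := by
    intro z; rw [inner_self_eq_norm_sq_to_K]; push_cast; rfl
  have h4 : ⟪u 1, star a (u 0)⟫_ℂ = (starRingEnd ℂ) ⟪u 0, a (u 1)⟫_ℂ := by
    rw [inner_conj_symm]
    exact ContinuousLinearMap.adjoint_inner_right a _ _
  simp only [Fin.sum_univ_two, h00, h01, h10, h11, one_apply_eq_self, h3, h4]
  have h5 : ‖⟪u 0, a (u 1)⟫_ℂ‖ ≤ ‖u 0‖ * ‖u 1‖ :=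
    (norm_inner_le_norm _ _).trans (by
      gcongr
      simpa using ContinuousLinearMap.le_of_opNorm_le _ ha (u 1))
  have h6 := (abs_le.1 ((Complex.abs_re_le_norm _).trans h5)).1
  rw [Complex.nonneg_iff]
  simp only [Complex.add_re, Complex.add_im, Complex.ofReal_re, Complex.ofReal_im, Complex.conj_re,
    Complex.conj_im]
  exact ⟨by nlinarith [sq_nonneg (‖u 0‖ - ‖u 1‖)], by ring⟩

/-- For `‖a‖ ≤ 1` the matrix with rows `(1, a)` and `(a*, 1)` is positive over `V`; its image is
positive with diagonal at most `1`, which bounds the corner `k t a`. -/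
theorem isContractiveMap_of_apply_one_le_one (hV : ∀ a ∈ V, star a ∈ V) {t : ℝ≥0}
    (hP : IsCompletelyPositive (k t)) (hle : (k t ⟨1, h1⟩).1 ≤ 1) : IsContractiveMap (k t) := by
  have hunit : ∀ a : V, ‖a‖ ≤ 1 → ‖k t a‖ ≤ 1 := by
    intro a ha
    obtain ⟨A, h00, h01, h10, h11⟩ : ∃ A : Fin 2 → Fin 2 → V, A 0 0 = ⟨1, h1⟩ ∧ A 0 1 = a ∧
        A 1 0 = ⟨star a.1, hV _ a.2⟩ ∧ A 1 1 = ⟨1, h1⟩ :=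
      ⟨![![⟨1, h1⟩, a], ![⟨star a.1, hV _ a.2⟩, ⟨1, h1⟩]], rfl, rfl, rfl, rfl⟩
    have h2 := hP.posMat A (posMat_two_of_norm_le_one (a := a.1) ha (by rw [h00]) (by rw [h01])
      (by rw [h10]) (by rw [h11]))
    have h3 := norm_le_one_of_posMat h2 (by rw [h00]; exact hle) (by rw [h11]; exact hle)
    rw [h01] at h3
    exact h3
  intro a
  rcases eq_or_ne a 0 with rfl | ha
  · simp
  · have hpos : 0 < ‖a‖ := norm_pos_iff.2 ha
    have h2 := hunit (((‖a‖ : ℂ)⁻¹) • a) (by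
      rw [norm_smul, norm_inv, Complex.norm_real, norm_norm, inv_mul_cancel₀ hpos.ne'])
    rw [map_smul, norm_smul, norm_inv, Complex.norm_real, norm_norm, inv_mul_le_iff₀ hpos,
      mul_one] at h2
    exact h2

theorem posSemidef_boxMat (n : ℕ) : (boxMat n).PosSemidef := by
  have := posSemidef_inner (ι := Fin n) fun _ => (1 : ℂ)
  simpa [boxMat] using this

theorem hadamard_boxMat {n : ℕ} (g : Matrix (Fin n) (Fin n) ℂ) : g ⊙ boxMat n = g := by
  ext i j
  simp [boxMat]

end Positivity

end QSC

end

/-! ### The equivalences -/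

theorem proposition5p2
    {H : Type*} [NormedAddCommGroup H] [InnerProductSpace ℂ H] [CompleteSpace H]
    {N : Type*} [NormedAddCommGroup N] [InnerProductSpace ℂ N] [CompleteSpace N]
    (V : Submodule ℂ (H →L[ℂ] H))
    (k : ℝ≥0 → V →ₗ[ℂ] QSC.matrixSpace V (QSC.NoiseFock N))
    (hk : QSC.IsQSCocycle V k)
    (S : Set N) (h0 : (0 : N) ∈ S) (hS : (Submodule.span ℂ S).topologicalClosure = ⊤) :
    -- (a) complete positivity
    ((QSC.IsOperatorSystem V ∨ QSC.IsConcreteCStarAlgebra V) →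
      List.TFAE [
        ∀ t, QSC.IsCompletelyPositive (k t),
        ∀ (n : ℕ) (x : Fin n → N), (∀ i, x i ∈ S) →
          ∀ t, QSC.IsCompletelyPositive (QSC.assocSchur k x t),
        ∀ (n : ℕ) (x : Fin n → N), (∀ i, x i ∈ S) →
          ∀ t, QSC.IsPositiveMap (QSC.assocSchur k x t)]) ∧
    -- (b) contractivity and unitality, for completely positive cocycles on an operator system
    (∀ hV : QSC.IsOperatorSystem V, (∀ t, QSC.IsCompletelyPositive (k t)) →
      List.TFAE [
        ∀ t, QSC.IsContractiveMap (k t),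
        ∀ (n : ℕ) (x : Fin n → N), (∀ i, x i ∈ S) →
          ∀ l : Matrix (Fin n) (Fin n) ℂ, l.PosSemidef → ∀ t,
            (QSC.assocSchur k x t (QSC.scalarMat hV.one_mem l)).1 ≤
              (QSC.scalarMat hV.one_mem (QSC.cohGram x t ⊙ l)).1,
        ∀ (n : ℕ) (x : Fin n → N), (∀ i, x i ∈ S) → ∀ t,
            (QSC.assocSchur k x t (QSC.scalarMat hV.one_mem (QSC.boxMat n))).1 ≤
              (QSC.scalarMat hV.one_mem (QSC.cohGram x t)).1] ∧
      ((∀ t, (k t ⟨1, hV.one_mem⟩).1 = 1) ↔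
        ∀ (n : ℕ) (x : Fin n → N), (∀ i, x i ∈ S) →
          ∀ l : Matrix (Fin n) (Fin n) ℂ, l.PosSemidef → ∀ t,
            QSC.assocSchur k x t (QSC.scalarMat hV.one_mem l) =
              QSC.scalarMat hV.one_mem (QSC.cohGram x t ⊙ l)) ∧
      ((∀ t, (k t ⟨1, hV.one_mem⟩).1 = 1) ↔
        ∀ (n : ℕ) (x : Fin n → N), (∀ i, x i ∈ S) → ∀ t,
            QSC.assocSchur k x t (QSC.scalarMat hV.one_mem (QSC.boxMat n)) =
              QSC.scalarMat hV.one_mem (QSC.cohGram x t))) ∧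
    -- (c) unitality, for completely positive contractive cocycles on an operator system
    (∀ hV : QSC.IsOperatorSystem V, (∀ t, QSC.IsCompletelyPositive (k t)) →
      (∀ t, QSC.IsContractiveMap (k t)) →
      List.TFAE [
        ∀ t, (k t ⟨1, hV.one_mem⟩).1 = 1,
        ∀ (n : ℕ) (x : Fin n → N), (∀ i, x i ∈ S) →
          ∀ l : Matrix (Fin n) (Fin n) ℂ, l.PosSemidef → ∀ t,
            QSC.assocSchur k x t (QSC.scalarMat hV.one_mem l) =
              QSC.scalarMat hV.one_mem (QSC.cohGram x t ⊙ l),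
        ∀ (n : ℕ) (x : Fin n → N), (∀ i, x i ∈ S) → ∀ t,
            QSC.assocSchur k x t (QSC.scalarMat hV.one_mem (QSC.boxMat n)) =
              QSC.scalarMat hV.one_mem (QSC.cohGram x t),
        ∀ x ∈ S, ∀ t, QSC.assocMap k x x t ⟨1, hV.one_mem⟩ = ⟨1, hV.one_mem⟩]) := by
  have hcoh : ∀ (x : N) (t : ℝ≥0), ⟪QSC.coh x t, QSC.coh x t⟫_ℂ = 1 := fun x t =>
    QSC.inner_expOn_self _
  have hunital : ∀ hV : QSC.IsOperatorSystem V,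
      ((∀ t, (k t ⟨1, hV.one_mem⟩).1 = 1) ↔
        ∀ (n : ℕ) (x : Fin n → N), (∀ i, x i ∈ S) →
          ∀ l : Matrix (Fin n) (Fin n) ℂ, l.PosSemidef → ∀ t,
            QSC.assocSchur k x t (QSC.scalarMat hV.one_mem l) =
              QSC.scalarMat hV.one_mem (QSC.cohGram x t ⊙ l)) ∧
      ((∀ t, (k t ⟨1, hV.one_mem⟩).1 = 1) ↔
        ∀ (n : ℕ) (x : Fin n → N), (∀ i, x i ∈ S) → ∀ t,
            QSC.assocSchur k x t (QSC.scalarMat hV.one_mem (QSC.boxMat n)) =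
              QSC.scalarMat hV.one_mem (QSC.cohGram x t)) := by
    intro hV
    have h12 : (∀ t, (k t ⟨1, hV.one_mem⟩).1 = 1) →
        ∀ (n : ℕ) (x : Fin n → N), (∀ i, x i ∈ S) →
          ∀ l : Matrix (Fin n) (Fin n) ℂ, l.PosSemidef → ∀ t,
            QSC.assocSchur k x t (QSC.scalarMat hV.one_mem l) =
              QSC.scalarMat hV.one_mem (QSC.cohGram x t ⊙ l) := by
      intro h n x _ l _ t
      rw [QSC.assocSchur_scalarMat_eq_iff]
      intro i j
      rw [QSC.coe_assocMap_one, h t, QSC.slice_one, smul_smul, Matrix.hadamard_apply, mul_comm]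
      rfl
    have h23 : (∀ (n : ℕ) (x : Fin n → N), (∀ i, x i ∈ S) →
          ∀ l : Matrix (Fin n) (Fin n) ℂ, l.PosSemidef → ∀ t,
            QSC.assocSchur k x t (QSC.scalarMat hV.one_mem l) =
              QSC.scalarMat hV.one_mem (QSC.cohGram x t ⊙ l)) →
        ∀ (n : ℕ) (x : Fin n → N), (∀ i, x i ∈ S) → ∀ t,
            QSC.assocSchur k x t (QSC.scalarMat hV.one_mem (QSC.boxMat n)) =
              QSC.scalarMat hV.one_mem (QSC.cohGram x t) := by
      intro h n x hx t
      have := h n x hx _ (QSC.posSemidef_boxMat n) t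
      rwa [QSC.hadamard_boxMat] at this
    have h31 : (∀ (n : ℕ) (x : Fin n → N), (∀ i, x i ∈ S) → ∀ t,
            QSC.assocSchur k x t (QSC.scalarMat hV.one_mem (QSC.boxMat n)) =
              QSC.scalarMat hV.one_mem (QSC.cohGram x t)) →
        ∀ t, (k t ⟨1, hV.one_mem⟩).1 = 1 := by
      intro h
      refine hk.apply_one_eq_one hV.one_mem h0 hS fun x hx y hy t => ?_
      -- The off-diagonal entry for the pair `(x, y)` already gives every `P^{x,y}_t(1)`.
      have h2 := (QSC.assocSchur_scalarMat_eq_iff hV.one_mem _ _ _ _).1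
        (h 2 ![x, y] (by intro i; fin_cases i <;> assumption) t) 0 1
      rw [QSC.boxMat, Matrix.of_apply, one_smul] at h2
      exact h2
    exact ⟨⟨h12, fun h => h31 (h23 h)⟩, ⟨fun h => h23 (h12 h), h31⟩⟩
  refine ⟨fun _ => ?_, fun hV hP => ⟨?_, hunital hV⟩, fun hV hP hC => ?_⟩
  · tfae_have 1 → 2 := fun h n x _ t => QSC.isCompletelyPositive_assocSchur (h t) x
    tfae_have 2 → 3 := fun h n x hx t => (h n x hx t).isPositiveMap
    tfae_have 3 → 1 := fun h t => hk.isCompletelyPositive h0 hS h t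
    tfae_finish
  · tfae_have 1 → 2 := by
      intro h n x _ l hl t
      rw [QSC.assocSchur_scalarMat_le_iff]
      -- The constant matrix with entries `1 - k_t(1)` is positive; it is sliced by the coherent
      -- vectors and then Schur multiplied by `l`.
      have h2 := ((QSC.posMat_const (ι := Fin n) (sub_nonneg.2
        (QSC.apply_one_le_one_of_contractive hV.one_mem (hP t) (h t)))).slice
          fun i => QSC.coh (x i) t).schur hl
      convert h2 using 3 with i j
      rw [map_sub, QSC.slice_one, smul_sub, smul_smul, Matrix.hadamard_apply, mul_comm]
      rfl
    tfae_have 2 → 3 := by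
      intro h n x hx t
      have := h n x hx _ (QSC.posSemidef_boxMat n) t
      rwa [QSC.hadamard_boxMat] at this
    tfae_have 3 → 1 := by
      intro h t
      refine QSC.isContractiveMap_of_apply_one_le_one hV.one_mem hV.2.1 (hP t) ?_
      refine hk.apply_one_le_one hV.one_mem h0 hS hP (fun n x hx t => ?_) t
      have h2 := (QSC.assocSchur_scalarMat_le_iff hV.one_mem _ _ _ _).1 (h n x hx t)
      simp only [QSC.boxMat, Matrix.of_apply, one_smul] at h2
      exact h2
    tfae_finish
  · tfae_have 1 ↔ 2 := (hunital hV).1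
    tfae_have 1 ↔ 3 := (hunital hV).2
    tfae_have 1 → 4 := by
      intro h x _ t
      refine Subtype.ext ?_
      rw [QSC.coe_assocMap_one, h t, QSC.slice_one, hcoh, one_smul]
    tfae_have 4 → 1 := by
      intro h
      refine hk.apply_one_eq_one hV.one_mem h0 hS fun x _ y hy t => ?_
      have hR := sub_nonneg.2
        (QSC.apply_one_le_one_of_contractive hV.one_mem (hP t) (hC t))
      -- Unitality of `P^{y,y}` makes the form of the positive operator `1 - k_t(1)` vanish at `v ⊗
      -- ϖ(y_[0,t[)`; pairing with `u ⊗ ϖ(x_[0,t[)` then yields the off-diagonal slices.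
      have hz : ∀ v : H, (1 - (k t ⟨1, hV.one_mem⟩).1) (QSC.htmul v (QSC.coh y t)) = 0 := by
        intro v
        refine QSC.apply_eq_zero_of_inner_eq_zero hR ?_
        have h2 := congrArg Subtype.val (h y hy t)
        rw [QSC.coe_assocMap_one] at h2
        rw [← QSC.inner_slice, map_sub, QSC.slice_one, h2, hcoh, one_smul, sub_self]
        simp
      refine ContinuousLinearMap.ext fun v => ext_inner_left ℂ fun u => ?_
      have h3 := congrArg (fun z => ⟪QSC.htmul u (QSC.coh x t), z⟫_ℂ) (hz v)
      simp only [inner_zero_right] at h3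
      rw [← QSC.inner_slice, map_sub, QSC.slice_one, _root_.sub_apply, inner_sub_right,
        sub_eq_zero] at h3
      exact h3.symm
    tfae_finish
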